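/- Notation. For $f\in\mathcal S(\mathbb R^d)$ let $\hat f(\xi)=\int_{\mathbb R^d} f(x)e^{-2\pi i\xi\cdot x}\,dx$, extended to $\mathcal S'(\mathbb R^d)$ by duality. For $z=(x,\xi)\in\mathbb R^2$ let $\pi(z)f(t)=e^{2\pi i\xi t}f(t-x)$ be the time-frequency shift. The bracket $\langle u,f\rangle$ of $u\in\mathcal S'$ and $f\in\mathcal S$ is linear in $u$ and conjugate-linear in $f$ (it extends the $L^2$ inner product $\int u\bar f$). For $f,g\in\mathcal S(\mathbb R)$ the Rihaczek distribution is $$R(f,g)(x,\xi)=f(x)\,\overline{\hat g(\xi)}\,e^{-2\pi i x\xi},$$ which belongs to $\mathcal S(\mathbb R^2)$. For $\sigma\in\mathcal S'(\mathbb R^2)$ the pseudodifferential operator $\sigma^{KN}:\mathcal S(\mathbb R)\to\mathcal S'(\mathbb R)$ with Kohn-Nirenberg symbol $\sigma$ is the linear operator defined by $\langle\sigma^{KN}f,g\rangle=\langle\sigma,R(g,f)\rangle$ for all $f,g\in\mathcal S(\mathbb R)$. Theorem. Let $\sigma\in\mathcal S'(\mathbb R^2)$, let $\varphi(x)=e^{-\pi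 x^2}$ be the Gaussian function on $\mathbb R$, and let $\Lambda=a\mathbb Z\times b\mathbb Z$ with arbitrary $a,b>0$. If $\hat\sigma$ has compact support and $$H_{\lambda\mu}=\langle\sigma^{KN}\pi(\mu)\varphi,\pi(\lambda)\varphi\rangle=0\qquad\text{for all }\lambda,\mu\in\Lambda,$$ then $\sigma^{KN}=0$, that is, $\sigma^{KN}f=0$ for every $f\in\mathcal S(\mathbb R)$. (No assumption is made on $ab$ or on the spanning properties of the Gabor system $\{\pi(\lambda)\varphi:\lambda\in\Lambda\}$ in $L^2(\mathbb R)$.) -/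

import Mathlib

open scoped SchwartzMap FourierTransform ContDiff

noncomputable section

namespace Gabor

/-- The Euclidean plane `ℝ²`; a point is written `z = (z 0, z 1) = (x, ξ)`. -/
abbrev Plane : Type := EuclideanSpace ℝ (Fin 2)

/-! ### The unimodular exponential `t ↦ e^{2πit}` -/

/-- `e^{2πit}` for real `t`. -/
def expI (t : ℝ) : ℂ := Complex.exp (2 * Real.pi * Complex.I * t)

theorem hasDerivAt_expI (t : ℝ) :
    HasDerivAt expI (2 * Real.pi * Complex.I * expI t) t := by
  have h : HasDerivAt (fun s : ℝ ↦ 2 * Real.pi * Complex.I * (s : ℂ))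
      (2 * Real.pi * Complex.I) t := by
    simpa using (Complex.ofRealCLM.hasDerivAt (x := t)).const_mul (2 * Real.pi * Complex.I)
  exact h.cexp.congr_deriv (mul_comm _ _)

theorem contDiff_expI : ContDiff ℝ ∞ expI := by
  have h : ContDiff ℝ ∞ (fun s : ℝ ↦ 2 * Real.pi * Complex.I * (s : ℂ)) :=
    contDiff_const.mul Complex.ofRealCLM.contDiff
  exact h.cexp

theorem iteratedDeriv_expI (n : ℕ) :
    iteratedDeriv n expI = fun t ↦ (2 * Real.pi * Complex.I) ^ n * expI t := by
  induction n with
  | zero => simp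
  | succ n ih =>
    rw [iteratedDeriv_succ, ih]
    funext t
    rw [((hasDerivAt_expI t).const_mul _).deriv]
    ring

theorem norm_expI (t : ℝ) : ‖expI t‖ = 1 := by
  have : expI t = Complex.exp ((2 * Real.pi * t : ℝ) * Complex.I) := by
    unfold expI
    congr 1
    push_cast
    ring
  rw [this, Complex.norm_exp_ofReal_mul_I]

theorem hasTemperateGrowth_expI : Function.HasTemperateGrowth expI := by
  refine ⟨contDiff_expI, fun n ↦ ⟨0, ‖(2 * Real.pi * Complex.I : ℂ) ^ n‖, fun t ↦ ?_⟩⟩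
  rw [norm_iteratedFDeriv_eq_norm_iteratedDeriv, iteratedDeriv_expI]
  simp [norm_expI]

theorem hasTemperateGrowth_modulation (ξ : ℝ) :
    Function.HasTemperateGrowth (fun t : ℝ ↦ expI (ξ * t)) := by
  have h : Function.HasTemperateGrowth (fun t : ℝ ↦ ξ * t) :=
    (Function.HasTemperateGrowth.const ξ).mul Function.HasTemperateGrowth.id'
  exact hasTemperateGrowth_expI.comp h

theorem hasTemperateGrowth_chirp :
    Function.HasTemperateGrowth (fun z : Plane ↦ expI (-(z 0 * z 1))) := by
  have h0 : Function.HasTemperateGrowth (fun z : Plane ↦ z 0) :=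
    (EuclideanSpace.proj (𝕜 := ℝ) (0 : Fin 2) : Plane →L[ℝ] ℝ).hasTemperateGrowth
  have h1 : Function.HasTemperateGrowth (fun z : Plane ↦ z 1) :=
    (EuclideanSpace.proj (𝕜 := ℝ) (1 : Fin 2) : Plane →L[ℝ] ℝ).hasTemperateGrowth
  exact hasTemperateGrowth_expI.comp (h0.mul h1).neg

/-! ### Conjugation, tensor products and the Gaussian as Schwartz functions -/

/-- Pointwise complex conjugation on a Schwartz space, as a conjugate-linear map. -/
def conjS (E : Type*) [NormedAddCommGroup E] [NormedSpace ℝ E] :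
    𝓢(E, ℂ) →SL[starRingEnd ℂ] 𝓢(E, ℂ) :=
  SchwartzMap.mkCLM (fun f x ↦ starRingEnd ℂ (f x)) (fun f g x ↦ by simp) (fun a f x ↦ by simp)
    (fun f ↦ (Complex.conjCLE : ℂ →L[ℝ] ℂ).contDiff.comp (f.smooth ⊤)) <| by
  rintro ⟨k, n⟩
  refine ⟨{(k, n)}, 1, zero_le_one, fun f x ↦ ?_⟩
  have h : ‖iteratedFDeriv ℝ n (fun x ↦ starRingEnd ℂ (f x)) x‖ = ‖iteratedFDeriv ℝ n f x‖ :=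
    Complex.conjLIE.norm_iteratedFDeriv_comp_left (f : E → ℂ) x n
  simpa [h] using SchwartzMap.le_seminorm ℂ k n f x

@[simp]
theorem conjS_apply {E : Type*} [NormedAddCommGroup E] [NormedSpace ℝ E] (f : 𝓢(E, ℂ)) (x : E) :
    conjS E f x = starRingEnd ℂ (f x) := rfl

theorem contDiff_tensor (f g : 𝓢(ℝ, ℂ)) : ContDiff ℝ ∞ (fun z : Plane ↦ f (z 0) * g (z 1)) :=
  ((f.smooth ⊤).comp (EuclideanSpace.proj (𝕜 := ℝ) (0 : Fin 2) : Plane →L[ℝ] ℝ).contDiff).mul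
    ((g.smooth ⊤).comp (EuclideanSpace.proj (𝕜 := ℝ) (1 : Fin 2) : Plane →L[ℝ] ℝ).contDiff)

theorem norm_iteratedFDeriv_coord_le (f : 𝓢(ℝ, ℂ)) (i : Fin 2) (n : ℕ) (z : Plane) :
    ‖iteratedFDeriv ℝ n (fun z : Plane ↦ f (z i)) z‖ ≤ ‖iteratedFDeriv ℝ n f (z i)‖ := by
  let p : Plane →L[ℝ] ℝ := EuclideanSpace.proj (𝕜 := ℝ) i
  have hp : ‖p‖ ≤ 1 := p.opNorm_le_bound zero_le_one fun z ↦ by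
    simpa [p] using PiLp.norm_apply_le z i
  have h := p.iteratedFDeriv_comp_right (f := f) (f.smooth ⊤) z (i := n) (mod_cast le_top)
  change ‖iteratedFDeriv ℝ n (f ∘ p) z‖ ≤ _
  rw [h]
  refine (ContinuousMultilinearMap.norm_compContinuousLinearMap_le _ _).trans ?_
  refine mul_le_of_le_one_right (norm_nonneg _) ?_
  exact Finset.prod_le_one (fun _ _ ↦ norm_nonneg _) fun _ _ ↦ hp

theorem tensor_decay (f g : 𝓢(ℝ, ℂ)) (k n : ℕ) (z : Plane) :
    ‖z‖ ^ k * ‖iteratedFDeriv ℝ n (fun z : Plane ↦ f (z 0) * g (z 1)) z‖ ≤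
      (2 ^ n * 2 ^ k * (2 ^ k * (Finset.Iic (k, n)).sup (schwartzSeminormFamily ℂ ℝ ℂ) g)) *
        (Finset.Iic (k, n)).sup (schwartzSeminormFamily ℂ ℝ ℂ) f := by
  set Sf := (Finset.Iic (k, n)).sup (schwartzSeminormFamily ℂ ℝ ℂ) f with hSf
  set Sg := (Finset.Iic (k, n)).sup (schwartzSeminormFamily ℂ ℝ ℂ) g with hSg
  have hz : ‖z‖ ≤ (1 + ‖z 0‖) * (1 + ‖z 1‖) := by
    rw [EuclideanSpace.norm_eq, Fin.sum_univ_two]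
    apply Real.sqrt_le_iff.2
    have h0 := norm_nonneg (z 0)
    have h1 := norm_nonneg (z 1)
    refine ⟨by positivity, ?_⟩
    have : 0 ≤ ‖z 0‖ * ‖z 1‖ := by positivity
    nlinarith [mul_nonneg this h0, mul_nonneg this h1, mul_nonneg this this]
  have hmul := norm_iteratedFDeriv_mul_le (𝕜 := ℝ) (N := ∞)
    (f := fun z : Plane ↦ f (z 0)) (g := fun z : Plane ↦ g (z 1))
    ((f.smooth ⊤).comp (EuclideanSpace.proj (𝕜 := ℝ) (0 : Fin 2) : Plane →L[ℝ] ℝ).contDiff)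
    ((g.smooth ⊤).comp (EuclideanSpace.proj (𝕜 := ℝ) (1 : Fin 2) : Plane →L[ℝ] ℝ).contDiff)
    z (n := n) (mod_cast le_top)
  calc
    _ ≤ ((1 + ‖z 0‖) * (1 + ‖z 1‖)) ^ k * ∑ i ∈ Finset.range (n + 1),
        (n.choose i : ℝ) * ‖iteratedFDeriv ℝ i (fun z : Plane ↦ f (z 0)) z‖ *
          ‖iteratedFDeriv ℝ (n - i) (fun z : Plane ↦ g (z 1)) z‖ := by gcongr
    _ ≤ ∑ i ∈ Finset.range (n + 1), (n.choose i : ℝ) * ((2 ^ k * Sf) * (2 ^ k * Sg)) := by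
      rw [Finset.mul_sum]
      refine Finset.sum_le_sum fun i hi ↦ ?_
      have hi' : i ≤ n := Nat.lt_succ_iff.1 (Finset.mem_range.1 hi)
      have hf := SchwartzMap.one_add_le_sup_seminorm_apply (𝕜 := ℂ) (m := (k, n))
        (k := k) (n := i) le_rfl hi' f (z 0)
      have hg := SchwartzMap.one_add_le_sup_seminorm_apply (𝕜 := ℂ) (m := (k, n))
        (k := k) (n := n - i) le_rfl (Nat.sub_le n i) g (z 1)
      have hf' := norm_iteratedFDeriv_coord_le f 0 i z
      have hg' := norm_iteratedFDeriv_coord_le g 1 (n - i) z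
      calc
        _ = (n.choose i : ℝ) *
            (((1 + ‖z 0‖) ^ k * ‖iteratedFDeriv ℝ i (fun z : Plane ↦ f (z 0)) z‖) *
             ((1 + ‖z 1‖) ^ k * ‖iteratedFDeriv ℝ (n - i) (fun z : Plane ↦ g (z 1)) z‖)) := by
          rw [mul_pow]
          ring
        _ ≤ (n.choose i : ℝ) *
            (((1 + ‖z 0‖) ^ k * ‖iteratedFDeriv ℝ i f (z 0)‖) *
             ((1 + ‖z 1‖) ^ k * ‖iteratedFDeriv ℝ (n - i) g (z 1)‖)) := by gcongr
        _ ≤ _ := mul_le_mul_of_nonneg_left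
          (mul_le_mul hf hg (by positivity) ((by positivity : (0 : ℝ) ≤ _).trans hf))
          (Nat.cast_nonneg _)
    _ = _ := by
      rw [← Finset.sum_mul]
      have : ∑ i ∈ Finset.range (n + 1), (n.choose i : ℝ) = 2 ^ n := by
        exact_mod_cast Nat.sum_range_choose n
      rw [this]
      ring

/-- The tensor product `(f ⊗ g)(x, ξ) = f(x) g(ξ)`, as a continuous linear map in `f`. -/
def tensorCLM (g : 𝓢(ℝ, ℂ)) : 𝓢(ℝ, ℂ) →L[ℂ] 𝓢(Plane, ℂ) :=
  SchwartzMap.mkCLM (fun f z ↦ f (z 0) * g (z 1)) (fun f f' z ↦ by simp [add_mul])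
    (fun a f z ↦ by simp [mul_assoc]) (fun f ↦ contDiff_tensor f g) <| by
  rintro ⟨k, n⟩
  refine ⟨Finset.Iic (k, n), _, ?_, fun f z ↦ tensor_decay f g k n z⟩
  have : 0 ≤ (Finset.Iic (k, n)).sup (schwartzSeminormFamily ℂ ℝ ℂ) g := apply_nonneg _ _
  positivity

@[simp]
theorem tensorCLM_apply (g f : 𝓢(ℝ, ℂ)) (z : Plane) :
    tensorCLM g f z = f (z 0) * g (z 1) := rfl

theorem iteratedDeriv_gaussian (n : ℕ) : ∃ p : Polynomial ℝ, ∀ x : ℝ,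
    iteratedDeriv n (fun x : ℝ ↦ ((Real.exp (-Real.pi * x ^ 2) : ℝ) : ℂ)) x =
      ((p.eval x * Real.exp (-Real.pi * x ^ 2) : ℝ) : ℂ) := by
  induction n with
  | zero => exact ⟨1, fun x ↦ by simp⟩
  | succ n ih =>
    obtain ⟨p, hp⟩ := ih
    refine ⟨p.derivative + p * (Polynomial.C (-2 * Real.pi) * Polynomial.X), fun x ↦ ?_⟩
    rw [iteratedDeriv_succ, funext hp]
    have h1 : HasDerivAt (fun x : ℝ ↦ -Real.pi * x ^ 2) (-Real.pi * (2 * x)) x := by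
      simpa using (hasDerivAt_pow 2 x).const_mul (-Real.pi)
    have h2 := ((p.hasDerivAt x).mul h1.exp).ofReal_comp
    refine h2.deriv.trans ?_
    congr 1
    simp only [Polynomial.eval_add, Polynomial.eval_mul, Polynomial.eval_C, Polynomial.eval_X]
    ring

theorem pow_mul_gaussian_le (j : ℕ) (x : ℝ) :
    |x| ^ j * Real.exp (-Real.pi * x ^ 2) ≤ 1 + (j.factorial : ℝ) := by
  have hpos := Real.exp_pos (-Real.pi * x ^ 2)
  have h1 : |x| ^ j ≤ 1 + (x ^ 2) ^ j := by
    rw [← sq_abs, ← pow_mul, mul_comm 2 j, pow_mul]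
    nlinarith [sq_nonneg (|x| ^ j - 1), pow_nonneg (abs_nonneg x) j]
  have h2 : (x ^ 2) ^ j ≤ j.factorial * Real.exp (x ^ 2) := by
    have := Real.pow_div_factorial_le_exp (x ^ 2) (sq_nonneg x) j
    rwa [div_le_iff₀ (by positivity), mul_comm] at this
  have h3 : Real.exp (x ^ 2) * Real.exp (-Real.pi * x ^ 2) ≤ 1 := by
    rw [← Real.exp_add]
    apply Real.exp_le_one_iff.2
    nlinarith [sq_nonneg x, Real.pi_gt_three]
  have h4 : Real.exp (-Real.pi * x ^ 2) ≤ 1 := by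
    apply Real.exp_le_one_iff.2
    nlinarith [sq_nonneg x, Real.pi_gt_three]
  calc
    _ ≤ (1 + j.factorial * Real.exp (x ^ 2)) * Real.exp (-Real.pi * x ^ 2) := by
      gcongr
      exact h1.trans (by gcongr)
    _ = Real.exp (-Real.pi * x ^ 2) +
        j.factorial * (Real.exp (x ^ 2) * Real.exp (-Real.pi * x ^ 2)) := by ring
    _ ≤ 1 + j.factorial * 1 := by gcongr
    _ = _ := by ring

/-- The Gaussian `φ(x) = e^{-πx²}`. -/
def gaussian : 𝓢(ℝ, ℂ) where
  toFun x := ((Real.exp (-Real.pi * x ^ 2) : ℝ) : ℂ)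
  smooth' := by
    have h : ContDiff ℝ ∞ (fun x : ℝ ↦ Real.exp (-Real.pi * x ^ 2)) := by fun_prop
    exact Complex.ofRealCLM.contDiff.comp h
  decay' k n := by
    obtain ⟨p, hp⟩ := iteratedDeriv_gaussian n
    refine ⟨∑ i ∈ Finset.range (p.natDegree + 1),
      |p.coeff i| * (1 + ((k + i).factorial : ℝ)), fun x ↦ ?_⟩
    rw [norm_iteratedFDeriv_eq_norm_iteratedDeriv, hp, Complex.norm_real, norm_mul,
      Real.norm_of_nonneg (Real.exp_pos _).le, Polynomial.eval_eq_sum_range, Real.norm_eq_abs,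
      Real.norm_eq_abs]
    calc
      _ ≤ |x| ^ k * ((∑ i ∈ Finset.range (p.natDegree + 1), |p.coeff i * x ^ i|) *
          Real.exp (-Real.pi * x ^ 2)) := by
        gcongr
        exact Finset.abs_sum_le_sum_abs _ _
      _ = ∑ i ∈ Finset.range (p.natDegree + 1),
          |p.coeff i| * (|x| ^ (k + i) * Real.exp (-Real.pi * x ^ 2)) := by
        rw [Finset.sum_mul, Finset.mul_sum]
        refine Finset.sum_congr rfl fun i _ ↦ ?_
        rw [abs_mul, abs_pow, pow_add]
        ring
      _ ≤ _ := by
        gcongr with i _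
        exact pow_mul_gaussian_le (k + i) x

@[simp]
theorem gaussian_apply (x : ℝ) : gaussian x = ((Real.exp (-Real.pi * x ^ 2) : ℝ) : ℂ) := rfl

/-! ### Time-frequency analysis -/

/-- The time-frequency shift `π(z) f (t) = e^{2πiξt} f(t - x)`, `z = (x, ξ)`. -/
def timeFreqShift (z : ℝ × ℝ) : 𝓢(ℝ, ℂ) →L[ℂ] 𝓢(ℝ, ℂ) :=
  (SchwartzMap.smulLeftCLM ℂ (fun t : ℝ ↦ expI (z.2 * t))).comp
    (SchwartzMap.compSubConstCLM ℂ z.1)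

theorem timeFreqShift_apply (z : ℝ × ℝ) (f : 𝓢(ℝ, ℂ)) (t : ℝ) :
    timeFreqShift z f t = expI (z.2 * t) * f (t - z.1) := by
  simp [timeFreqShift, SchwartzMap.smulLeftCLM_apply_apply (hasTemperateGrowth_modulation z.2)]

/-- The lattice `aℤ × bℤ` in the time-frequency plane. -/
def lattice (a b : ℝ) : AddSubgroup (ℝ × ℝ) :=
  (AddSubgroup.zmultiples a).prod (AddSubgroup.zmultiples b)

/-- The duality bracket `⟨u, f⟩`, linear in the tempered distribution `u` and conjugate-linear in
the Schwartz function `f`; it extends the inner product `∫ u f̄` of `L²`. -/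
def bracket {E : Type*} [NormedAddCommGroup E] [NormedSpace ℝ E] (u : 𝓢'(E, ℂ)) (f : 𝓢(E, ℂ)) : ℂ :=
  u (conjS E f)

/-- The Rihaczek distribution `R(f, g)(x, ξ) = f(x) conj(ĝ(ξ)) e^{-2πixξ}`, as a continuous linear
map in `f`. -/
def rihaczekCLM (g : 𝓢(ℝ, ℂ)) : 𝓢(ℝ, ℂ) →L[ℂ] 𝓢(Plane, ℂ) :=
  (SchwartzMap.smulLeftCLM ℂ (fun z : Plane ↦ expI (-(z 0 * z 1)))).comp
    (tensorCLM (conjS ℝ (𝓕 g)))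

/-- The Rihaczek distribution `R(f, g)`. -/
def rihaczek (f g : 𝓢(ℝ, ℂ)) : 𝓢(Plane, ℂ) := rihaczekCLM g f

theorem rihaczek_apply (f g : 𝓢(ℝ, ℂ)) (z : Plane) :
    rihaczek f g z = f (z 0) * starRingEnd ℂ (𝓕 g (z 1)) * expI (-(z 0 * z 1)) := by
  simp [rihaczek, rihaczekCLM, SchwartzMap.smulLeftCLM_apply_apply hasTemperateGrowth_chirp,
    mul_comm]

/-- The pseudodifferential operator `σ^{KN} : 𝓢(ℝ) → 𝓢'(ℝ)` with Kohn-Nirenberg symbol `σ`.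
As a linear functional, `σ^{KN} f` sends `h` to `⟨σ, R(h̄, f)⟩`, so that
`⟨σ^{KN} f, g⟩ = ⟨σ, R(g, f)⟩` (see `bracket_kohnNirenberg`). -/
def kohnNirenberg (σ : 𝓢'(Plane, ℂ)) : 𝓢(ℝ, ℂ) →ₗ[ℂ] 𝓢'(ℝ, ℂ) where
  toFun f := PointwiseConvergenceCLM.precomp ℂ
    ((conjS Plane).comp ((rihaczekCLM f).comp (conjS ℝ)) : 𝓢(ℝ, ℂ) →L[ℂ] 𝓢(Plane, ℂ)) σ
  map_add' f f' := by
    ext h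
    change σ (conjS Plane (rihaczek (conjS ℝ h) (f + f'))) =
      σ (conjS Plane (rihaczek (conjS ℝ h) f)) + σ (conjS Plane (rihaczek (conjS ℝ h) f'))
    rw [← map_add, ← map_add]
    congr 2
    ext z
    simp [rihaczek_apply, FourierTransform.fourier_add]
    ring
  map_smul' c f := by
    ext h
    change σ (conjS Plane (rihaczek (conjS ℝ h) (c • f))) =
      c • σ (conjS Plane (rihaczek (conjS ℝ h) f))
    rw [← map_smul]
    congr 1
    ext z
    simp [rihaczek_apply, FourierTransform.fourier_smul]
    ring

theorem bracket_kohnNirenberg (σ : 𝓢'(Plane, ℂ)) (f g : 𝓢(ℝ, ℂ)) :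
    bracket (kohnNirenberg σ f) g = bracket σ (rihaczek g f) := by
  change σ (conjS Plane (rihaczek (conjS ℝ (conjS ℝ g)) f)) = σ (conjS Plane (rihaczek g f))
  congr 3
  ext x
  simp

/-- The entry `H_{λμ} = ⟨σ^{KN} π(μ) g, π(λ) g⟩` of the channel matrix. -/
def channelMatrix (σ : 𝓢'(Plane, ℂ)) (g : 𝓢(ℝ, ℂ)) (l m : ℝ × ℝ) : ℂ :=
  bracket (kohnNirenberg σ (timeFreqShift m g)) (timeFreqShift l g)

end Gabor

end

/-! Let τ be the Fourier transform of σ. The proof uses only the entries H with μ = -λ. For these,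
the inverse Fourier transform of the conjugated Rihaczek distribution carries no modulation: up to a
fixed chirp it is a Gaussian translated by a multiple of λ. A translated Gaussian is a nonzero
constant times the original Gaussian times a real exponential. So, with G the function for λ = 0,
the hypothesis says that τ kills G(w) exp(2π(q w₀ - p w₁)) for every λ = (p, q) in Λ
(`spreadingGaussian_eq_mul`, `fourier_apply_spreadingGaussian`).

Taking p = -an, q = bm with m, n natural turns the exponential into the monomial XᵐYⁿ in X = exp(2πb
w₀), Y = exp(2πa w₁). The map w ↦ (X, Y) is a diffeomorphism of the plane onto the open first
quadrant, and G has no zeros. Hence the push-forward of Gτ is a compactly supported distribution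
that kills all polynomials, and it must vanish because polynomials are dense in the smooth functions
(`eq_zero_of_apply_mul_pow`). Any steps a, b > 0 give enough monomials, which is why the density of
Λ plays no role.

The density of polynomials is proved by Fourier analysis (`OrderBound.eq_zero`). A compactly
supported distribution is bounded by finitely many derivatives on a compact set Q. In that norm the
Taylor series of exp(2πi ξ·x) converges, so exponentials are killed (`apply_expI_eq_zero`). A
Schwartz function is an integral of exponentials, convergent in the Banach space of N-jets on Q, so
it is killed as well. -/

noncomputable section

namespace Gabor

/-! ### Cutoffs and supports of tempered distributions -/

section Cutoff

variable {E : Type*} [NormedAddCommGroup E] [NormedSpace ℝ E]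

/-- Product of a Schwartz function with a smooth compactly supported function. -/
def cutoff (χ u : 𝓢(E, ℂ)) : 𝓢(E, ℂ) := SchwartzMap.smulLeftCLM ℂ χ u

@[simp]
theorem cutoff_apply (χ u : 𝓢(E, ℂ)) (x : E) : cutoff χ u x = χ x * u x := by
  simp [cutoff, SchwartzMap.smulLeftCLM_apply_apply χ.hasTemperateGrowth]

/-- The dilated cutoff `χ(x / R)`. -/
def dilate (χ : 𝓢(E, ℂ)) {R : ℝ} (hR : R ≠ 0) : 𝓢(E, ℂ) :=
  SchwartzMap.compCLMOfContinuousLinearEquiv ℂ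
    (ContinuousLinearEquiv.smulLeft (Units.mk0 R⁻¹ (inv_ne_zero hR))) χ

@[simp]
theorem dilate_apply (χ : 𝓢(E, ℂ)) {R : ℝ} (hR : R ≠ 0) (x : E) :
    dilate χ hR x = χ (R⁻¹ • x) := rfl

/-- Each derivative of the dilated cutoff gains a factor 1/R ≤ 1, so the bound is uniform in R. -/
theorem norm_iteratedFDeriv_dilate_le (χ : 𝓢(E, ℂ)) {R : ℝ} (hR : 1 ≤ R) (i : ℕ) (x : E) :
    ‖iteratedFDeriv ℝ i (fun x : E ↦ 1 - χ (R⁻¹ • x)) x‖ ≤ 1 + SchwartzMap.seminorm ℝ 0 i χ := by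
  have hR0 : 0 < R := by linarith
  have hc : ContDiff ℝ i (fun x : E ↦ χ (R⁻¹ • x)) :=
    ((χ.smooth ⊤).comp (contDiff_const_smul R⁻¹)).of_le (mod_cast le_top)
  have h1 : iteratedFDeriv ℝ i (fun x : E ↦ 1 - χ (R⁻¹ • x)) x =
      iteratedFDeriv ℝ i (fun _ : E ↦ (1 : ℂ)) x -
        iteratedFDeriv ℝ i (fun x : E ↦ χ (R⁻¹ • x)) x :=
    iteratedFDeriv_sub_apply contDiff_const.contDiffAt hc.contDiffAt
  rw [h1]
  refine (norm_sub_le _ _).trans (add_le_add ?_ ?_)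
  · cases i with
    | zero => simp
    | succ i => simp [iteratedFDeriv_const_of_ne]
  · have h2 := (R⁻¹ • ContinuousLinearMap.id ℝ E).iteratedFDeriv_comp_right (f := χ)
      (χ.smooth ⊤) x (i := i) (mod_cast le_top)
    change ‖iteratedFDeriv ℝ i (χ ∘ (R⁻¹ • ContinuousLinearMap.id ℝ E)) x‖ ≤ _
    rw [h2]
    refine (ContinuousMultilinearMap.norm_compContinuousLinearMap_le _ _).trans ?_
    have h3 : ‖R⁻¹ • ContinuousLinearMap.id ℝ E‖ ≤ 1 := by
      rw [norm_smul, norm_inv, Real.norm_of_nonneg hR0.le]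
      exact mul_le_one₀ (inv_le_one_of_one_le₀ hR) (norm_nonneg _)
        ContinuousLinearMap.norm_id_le
    refine (mul_le_of_le_one_right (norm_nonneg _)
      (Finset.prod_le_one (fun _ _ ↦ norm_nonneg _) fun _ _ ↦ h3)).trans ?_
    exact SchwartzMap.norm_iteratedFDeriv_le_seminorm ℝ χ i _

/-- The difference vanishes for ‖x‖ < R. Elsewhere 1 ≤ ‖x‖/R, and the extra power of ‖x‖ is absorbed
by the seminorm of u of weight k + 1. -/
theorem seminorm_sub_cutoff_dilate_le (χ : 𝓢(E, ℂ)) (hχ : ∀ x, ‖x‖ < 1 → χ x = 1) (u : 𝓢(E, ℂ))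
    (k n : ℕ) : ∃ B : ℝ, ∀ (R : ℝ) (hR : 1 ≤ R),
      SchwartzMap.seminorm ℂ k n (u - cutoff (dilate χ (by linarith : R ≠ 0)) u) ≤ B / R := by
  refine ⟨∑ i ∈ Finset.range (n + 1), (n.choose i : ℝ) * (1 + SchwartzMap.seminorm ℝ 0 i χ) *
    SchwartzMap.seminorm ℝ (k + 1) (n - i) u, fun R hR ↦ ?_⟩
  have hR0 : 0 < R := by linarith
  have hB : 0 ≤ ∑ i ∈ Finset.range (n + 1), (n.choose i : ℝ) *
      (1 + SchwartzMap.seminorm ℝ 0 i χ) * SchwartzMap.seminorm ℝ (k + 1) (n - i) u :=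
    Finset.sum_nonneg fun i _ ↦ by
      have := apply_nonneg (SchwartzMap.seminorm ℝ 0 i) χ
      have := apply_nonneg (SchwartzMap.seminorm ℝ (k + 1) (n - i)) u
      positivity
  refine SchwartzMap.seminorm_le_bound ℂ k n _ (by positivity) fun x ↦ ?_
  have hfun : ⇑(u - cutoff (dilate χ hR0.ne') u) = fun x ↦ (1 - χ (R⁻¹ • x)) * u x := by
    funext x
    simp
    ring
  rw [hfun]
  rcases lt_or_ge ‖x‖ R with hx | hx
  · have hz : (fun x ↦ (1 - χ (R⁻¹ • x)) * u x) =ᶠ[nhds x] fun _ ↦ 0 := by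
      filter_upwards [(isOpen_lt continuous_norm continuous_const).mem_nhds hx] with y hy
      rw [hχ, sub_self, zero_mul]
      rw [norm_smul, norm_inv, Real.norm_of_nonneg hR0.le, inv_mul_lt_iff₀ hR0, mul_one]
      exact hy
    rw [(hz.iteratedFDeriv ℝ n).eq_of_nhds]
    have : iteratedFDeriv ℝ n (fun _ : E ↦ (0 : ℂ)) x = 0 := by simp
    rw [this, norm_zero, mul_zero]
    positivity
  · have hc : ContDiff ℝ ∞ (fun x : E ↦ 1 - χ (R⁻¹ • x)) :=
      contDiff_const.sub ((χ.smooth ⊤).comp (contDiff_const_smul R⁻¹))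
    have hmul := norm_iteratedFDeriv_mul_le (𝕜 := ℝ) (N := ∞) hc (u.smooth ⊤) x (n := n)
      (mod_cast le_top)
    rw [le_div_iff₀ hR0]
    calc _ ≤ ‖x‖ ^ k * (∑ i ∈ Finset.range (n + 1), (n.choose i : ℝ) *
            ‖iteratedFDeriv ℝ i (fun x : E ↦ 1 - χ (R⁻¹ • x)) x‖ *
            ‖iteratedFDeriv ℝ (n - i) u x‖) * ‖x‖ := by gcongr
      _ = ∑ i ∈ Finset.range (n + 1), (n.choose i : ℝ) *
            ‖iteratedFDeriv ℝ i (fun x : E ↦ 1 - χ (R⁻¹ • x)) x‖ *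
            (‖x‖ ^ (k + 1) * ‖iteratedFDeriv ℝ (n - i) u x‖) := by
          rw [Finset.mul_sum, Finset.sum_mul]
          exact Finset.sum_congr rfl fun i _ ↦ by ring
      _ ≤ _ := by
          refine Finset.sum_le_sum fun i _ ↦ ?_
          have := apply_nonneg (SchwartzMap.seminorm ℝ 0 i) χ
          gcongr
          · exact norm_iteratedFDeriv_dilate_le χ hR i x
          · exact SchwartzMap.le_seminorm ℝ _ _ u x

theorem tendsto_cutoff_dilate (χ : 𝓢(E, ℂ)) (hχ : ∀ x, ‖x‖ < 1 → χ x = 1) (u : 𝓢(E, ℂ)) :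
    Filter.Tendsto (fun j : ℕ ↦ cutoff (dilate χ (by positivity : (j + 1 : ℝ) ≠ 0)) u)
      Filter.atTop (nhds u) := by
  rw [(schwartz_withSeminorms ℂ E ℂ).tendsto_nhds]
  rintro ⟨k, n⟩ ε hε
  obtain ⟨B, hB⟩ := seminorm_sub_cutoff_dilate_le χ hχ u k n
  have hlim : Filter.Tendsto (fun j : ℕ ↦ B / (j + 1 : ℝ)) Filter.atTop (nhds 0) :=
    tendsto_const_div_atTop_nhds_zero_nat B |>.comp (Filter.tendsto_add_atTop_nat 1) |>.congr
      fun j ↦ by simp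
  filter_upwards [hlim.eventually (gt_mem_nhds hε)] with j hj
  rw [← neg_sub, map_neg_eq_map]
  exact (hB (j + 1) (by linarith [(Nat.cast_nonneg j : (0 : ℝ) ≤ j)])).trans_lt hj

theorem hasCompactSupport_cutoff {χ : 𝓢(E, ℂ)} (hχ : HasCompactSupport χ) (u : 𝓢(E, ℂ)) :
    HasCompactSupport (cutoff χ u) := by
  have : ⇑(cutoff χ u) = fun x ↦ χ x * u x := funext (cutoff_apply χ u)
  rw [this]
  exact hχ.mul_right

theorem tsupport_cutoff_subset (χ u : 𝓢(E, ℂ)) : tsupport (cutoff χ u) ⊆ tsupport u := by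
  have : ⇑(cutoff χ u) = fun x ↦ χ x * u x := funext (cutoff_apply χ u)
  rw [this]
  exact tsupport_mul_subset_right

end Cutoff

/-! ### Localization: compact cutoffs and partitions of unity -/

section Support

variable {E : Type*} [NormedAddCommGroup E] [NormedSpace ℝ E] [FiniteDimensional ℝ E]

/-- Being 1 on an open neighbourhood, not only on K, is what makes the closed support of u - χu
disjoint from K. -/
theorem exists_cutoff_one_near (K : Set E) (hK : IsCompact K) :
    ∃ χ : 𝓢(E, ℂ), HasCompactSupport χ ∧ ∃ U, IsOpen U ∧ K ⊆ U ∧ ∀ x ∈ U, χ x = 1 := by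
  obtain ⟨R, hR0, hR⟩ := hK.isBounded.subset_ball_lt 0 0
  let φ : ContDiffBump (0 : E) := ⟨R, R + 1, hR0, by linarith⟩
  have h1 : HasCompactSupport (fun x ↦ ((φ x : ℝ) : ℂ)) :=
    φ.hasCompactSupport.comp_left (g := fun t : ℝ ↦ (t : ℂ)) Complex.ofReal_zero
  have h2 : ContDiff ℝ ∞ (fun x ↦ ((φ x : ℝ) : ℂ)) := Complex.ofRealCLM.contDiff.comp φ.contDiff
  refine ⟨h1.toSchwartzMap h2, h1, Metric.ball 0 R, Metric.isOpen_ball, hR, fun x hx ↦ ?_⟩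
  have : φ x = 1 := φ.one_of_mem_closedBall (Metric.ball_subset_closedBall hx)
  simp [this]

/-- To vanish on a Schwartz function it is enough to vanish on its compactly supported cutoffs. -/
theorem apply_eq_zero_of_cutoff (τ : 𝓢'(E, ℂ)) (u : 𝓢(E, ℂ))
    (h : ∀ χ : 𝓢(E, ℂ), HasCompactSupport χ → τ (cutoff χ u) = 0) : τ u = 0 := by
  obtain ⟨χ, hχc, U, -, hKU, hU⟩ := exists_cutoff_one_near (E := E) _ (isCompact_closedBall 0 1)
  have hlim := ((τ : 𝓢(E, ℂ) →L[ℂ] ℂ).continuous.tendsto u).comp (tendsto_cutoff_dilate χ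
    (fun x hx ↦ hU x (hKU (by simpa using hx.le))) u)
  refine tendsto_nhds_unique hlim (tendsto_const_nhds.congr fun j ↦ ?_)
  refine (h _ ?_).symm
  exact hχc.comp_homeomorph
    (ContinuousLinearEquiv.smulLeft (Units.mk0 ((j + 1 : ℝ))⁻¹ _) : E ≃L[ℝ] E).toHomeomorph

open scoped Manifold in
/-- A tempered distribution vanishes on Schwartz functions supported off its support. -/
theorem apply_eq_zero_of_tsupport_subset (τ : 𝓢'(E, ℂ)) (u : 𝓢(E, ℂ))
    (hu : tsupport u ⊆ (Distribution.dsupport τ)ᶜ) : τ u = 0 := by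
  refine apply_eq_zero_of_cutoff τ u fun χ hχ ↦ ?_
  have hc := hasCompactSupport_cutoff hχ u
  have hs := (tsupport_cutoff_subset χ u).trans hu
  generalize cutoff χ u = f at hc hs
  rw [Distribution.dsupport_compl_eq, Set.sUnion_eq_iUnion] at hs
  -- The complement of the support is a union of open sets on each of which τ vanishes. A partition
  -- of unity subordinate to them splits f into pieces killed by τ, finitely many because f has
  -- compact support.
  obtain ⟨ρ, hρ⟩ := SmoothPartitionOfUnity.exists_isSubordinate 𝓘(ℝ, E) (isClosed_tsupport f)
    _ (fun i ↦ i.2.2) hs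
  have hfin := ρ.locallyFinite.finite_nonempty_inter_compact hc
  have hsm (i) : ContDiff ℝ ∞ (fun x ↦ ((ρ i x : ℝ) : ℂ)) :=
    Complex.ofRealCLM.contDiff.comp (ρ i).contMDiff.contDiff
  have hci (i) : HasCompactSupport (fun x ↦ ((ρ i x : ℝ) : ℂ) * f x) := hc.mul_left
  let g (i) : 𝓢(E, ℂ) := (hci i).toSchwartzMap ((hsm i).mul (f.smooth ⊤))
  have hg (i) (x) : g i x = ((ρ i x : ℝ) : ℂ) * f x := rfl
  have hsum : f = ∑ i ∈ hfin.toFinset, g i := by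
    ext x
    rw [sum_apply]
    simp_rw [hg]
    rw [← Finset.sum_mul]
    by_cases hx : x ∈ tsupport f
    · have h1 : ∑ i ∈ hfin.toFinset, ρ i x = 1 := by
        rw [← ρ.sum_eq_one hx]
        refine (finsum_eq_sum_of_support_subset _ fun i hi ↦ ?_).symm
        simp only [Set.Finite.coe_toFinset]
        exact ⟨x, hi, hx⟩
      rw [← Complex.ofReal_sum, h1, Complex.ofReal_one, one_mul]
    · rw [image_eq_zero_of_notMem_tsupport hx, mul_zero]
  rw [hsum, map_sum]
  refine Finset.sum_eq_zero fun i _ ↦ i.2.1 (g i) ?_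
  refine subset_trans (closure_mono fun x hx ↦ ?_) (hρ i)
  rw [Function.mem_support, hg] at hx
  intro h0
  simp [h0] at hx

end Support

/-! ### Remainders of the exponential series -/

/-- The remainder after `K` terms of the Taylor series of `expI` at `0`. -/
def expITail (K : ℕ) (t : ℝ) : ℂ :=
  expI t - ∑ k ∈ Finset.range K, (2 * Real.pi * Complex.I * t) ^ k / (k.factorial : ℂ)

theorem contDiff_expITail (K : ℕ) : ContDiff ℝ ∞ (expITail K) := by
  unfold expITail
  have h : ContDiff ℝ ∞ (fun s : ℝ ↦ 2 * Real.pi * Complex.I * (s : ℂ)) :=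
    contDiff_const.mul Complex.ofRealCLM.contDiff
  exact contDiff_expI.sub (ContDiff.sum fun k _ ↦ (h.pow k).div_const _)

/-- Differentiation shifts the exponential series by one term, so n derivatives of a remainder are
again a remainder with n fewer terms removed. -/
theorem hasDerivAt_expITail (K : ℕ) (t : ℝ) :
    HasDerivAt (expITail (K + 1)) (2 * Real.pi * Complex.I * expITail K t) t := by
  have h : HasDerivAt (fun s : ℝ ↦ 2 * Real.pi * Complex.I * (s : ℂ))
      (2 * Real.pi * Complex.I) t := by
    simpa using (Complex.ofRealCLM.hasDerivAt (x := t)).const_mul (2 * Real.pi * Complex.I)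
  have h1 := (hasDerivAt_expI t).sub (HasDerivAt.fun_sum (u := Finset.range (K + 1))
    fun k _ ↦ (h.pow k).div_const (k.factorial : ℂ))
  refine h1.congr_deriv ?_
  unfold expITail
  rw [mul_sub, Finset.sum_range_succ', Finset.mul_sum]
  simp only [CharP.cast_eq_zero, zero_mul, zero_div, add_zero]
  congr 1
  refine Finset.sum_congr rfl fun k _ ↦ ?_
  rw [Nat.factorial_succ]
  have : (k.factorial : ℂ) ≠ 0 := by exact_mod_cast k.factorial_ne_zero
  have : (k + 1 : ℂ) ≠ 0 := by exact_mod_cast k.succ_ne_zero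
  push_cast
  field_simp

theorem iteratedDeriv_expITail (n K : ℕ) :
    iteratedDeriv n (expITail (K + n)) = fun t ↦ (2 * Real.pi * Complex.I) ^ n * expITail K t := by
  induction n generalizing K with
  | zero => simp
  | succ n ih =>
    rw [iteratedDeriv_succ, show K + (n + 1) = (K + 1) + n by ring, ih]
    funext t
    rw [((hasDerivAt_expITail K t).const_mul _).deriv]
    ring

theorem norm_expITail_le (K : ℕ) {t r : ℝ} (h : 2 * Real.pi * |t| ≤ r) :
    ‖expITail K t‖ ≤ Real.exp r - ∑ k ∈ Finset.range K, r ^ k / (k.factorial : ℝ) := by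
  have hs (s : ℝ) : HasSum (fun k : ℕ ↦ s ^ k / (k.factorial : ℝ)) (Real.exp s) := by
    rw [Real.exp_eq_exp_ℝ]
    exact NormedSpace.expSeries_div_hasSum_exp s
  have heq (s : ℝ) : Real.exp s - ∑ k ∈ Finset.range K, s ^ k / (k.factorial : ℝ) =
      ∑' k : ℕ, s ^ (k + K) / ((k + K).factorial : ℝ) := by
    rw [← (hs s).tsum_eq, ← (hs s).summable.sum_add_tsum_nat_add K]
    ring
  have hn : ‖(2 * Real.pi * Complex.I * t : ℂ)‖ = 2 * Real.pi * |t| := by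
    simp [abs_of_pos Real.pi_pos]
  refine (Complex.norm_exp_sub_sum_le_exp_norm_sub_sum _ K).trans ?_
  rw [hn, heq, heq]
  refine Summable.tsum_le_tsum (fun k ↦ ?_) ?_ ?_
  · have := Real.pi_pos
    gcongr
  · exact (summable_nat_add_iff K).2 (hs _).summable
  · exact (summable_nat_add_iff K).2 (hs _).summable

theorem tendsto_exp_sub_sum (r : ℝ) :
    Filter.Tendsto (fun K ↦ Real.exp r - ∑ k ∈ Finset.range K, r ^ k / (k.factorial : ℝ))
      Filter.atTop (nhds 0) := by
  have hs : HasSum (fun k : ℕ ↦ r ^ k / (k.factorial : ℝ)) (Real.exp r) := by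
    rw [Real.exp_eq_exp_ℝ]
    exact NormedSpace.expSeries_div_hasSum_exp r
  simpa using hs.tendsto_sum_nat.const_sub (Real.exp r)

/-! ### Functionals on smooth functions controlled by finitely many derivatives on a compact set -/

/-- The space of smooth complex functions. -/
def smoothFunctions (E : Type*) [NormedAddCommGroup E] [NormedSpace ℝ E] :
    Submodule ℂ (E → ℂ) where
  carrier := {f | ContDiff ℝ ∞ f}
  add_mem' {f g} (hf : ContDiff ℝ ∞ f) (hg : ContDiff ℝ ∞ g) := hf.add hg
  zero_mem' := (contDiff_const : ContDiff ℝ ∞ fun _ : E ↦ (0 : ℂ))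
  smul_mem' c f (hf : ContDiff ℝ ∞ f) := hf.const_smul c

theorem contDiff_smoothFunctions {E : Type*} [NormedAddCommGroup E] [NormedSpace ℝ E]
    (f : smoothFunctions E) : ContDiff ℝ ∞ (f : E → ℂ) := f.2

section Functional

variable {E : Type*} [NormedAddCommGroup E] [InnerProductSpace ℝ E]

theorem contDiff_ridge {φ : ℝ → ℂ} (hφ : ContDiff ℝ ∞ φ) (ξ : E) :
    ContDiff ℝ ∞ (fun x : E ↦ φ (inner ℝ ξ x)) :=
  hφ.comp (innerSL ℝ ξ).contDiff

theorem norm_iteratedFDeriv_ridge_le {φ : ℝ → ℂ} (hφ : ContDiff ℝ ∞ φ) (ξ x : E) (n : ℕ) :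
    ‖iteratedFDeriv ℝ n (fun x : E ↦ φ (inner ℝ ξ x)) x‖ ≤
      ‖iteratedDeriv n φ (inner ℝ ξ x)‖ * ‖ξ‖ ^ n := by
  have h := (innerSL ℝ ξ).iteratedFDeriv_comp_right (f := φ) hφ x (i := n) (mod_cast le_top)
  change ‖iteratedFDeriv ℝ n (φ ∘ (innerSL ℝ ξ)) x‖ ≤ _
  rw [h]
  refine (ContinuousMultilinearMap.norm_compContinuousLinearMap_le _ _).trans ?_
  rw [norm_iteratedFDeriv_eq_norm_iteratedDeriv]
  simp

theorem iteratedFDeriv_ridge_apply {φ : ℝ → ℂ} (hφ : ContDiff ℝ ∞ φ) (ξ x : E) (n : ℕ)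
    (m : Fin n → E) :
    iteratedFDeriv ℝ n (fun x : E ↦ φ (inner ℝ ξ x)) x m =
      (∏ i, inner ℝ ξ (m i)) • iteratedDeriv n φ (inner ℝ ξ x) := by
  have h := (innerSL ℝ ξ).iteratedFDeriv_comp_right (f := φ) hφ x (i := n) (mod_cast le_top)
  change iteratedFDeriv ℝ n (φ ∘ (innerSL ℝ ξ)) x m = _
  rw [h, ContinuousMultilinearMap.compContinuousLinearMap_apply,
    iteratedFDeriv_apply_eq_iteratedDeriv_mul_prod]
  simp

/-- A functional on smooth functions is of order `N` on `Q` with constant `C`. -/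
def OrderBound (S : smoothFunctions E →ₗ[ℂ] ℂ) (Q : Set E) (N : ℕ) (C : ℝ) : Prop :=
  ∀ (f : smoothFunctions E) (M : ℝ), 0 ≤ M →
    (∀ n ≤ N, ∀ y ∈ Q, ‖iteratedFDeriv ℝ n (f : E → ℂ) y‖ ≤ M) → ‖S f‖ ≤ C * M

variable {S : smoothFunctions E →ₗ[ℂ] ℂ} {Q : Set E} {N : ℕ} {C : ℝ}

theorem contDiff_inner_pow (ξ : E) (k : ℕ) :
    ContDiff ℝ ∞ (fun x : E ↦ ((inner ℝ ξ x : ℝ) : ℂ) ^ k) :=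
  (Complex.ofRealCLM.contDiff.comp (innerSL ℝ ξ).contDiff).pow k

/-- A functional of finite order on a compact set that vanishes on the powers of a linear form
vanishes on its exponential. -/
theorem apply_expI_eq_zero (hQ : IsCompact Q) (hS : OrderBound S Q N C) (ξ : E)
    (hpow : ∀ k, S ⟨fun x ↦ ((inner ℝ ξ x : ℝ) : ℂ) ^ k, contDiff_inner_pow ξ k⟩ = 0) :
    S ⟨fun x ↦ expI (inner ℝ ξ x), contDiff_ridge contDiff_expI ξ⟩ = 0 := by
  obtain ⟨R, hR⟩ := hQ.isBounded.exists_norm_le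
  have hpi := Real.pi_pos
  have htail (K : ℕ) : S ⟨fun x ↦ expI (inner ℝ ξ x), contDiff_ridge contDiff_expI ξ⟩ =
      S ⟨fun x ↦ expITail K (inner ℝ ξ x), contDiff_ridge (contDiff_expITail K) ξ⟩ := by
    have : (⟨fun x ↦ expITail K (inner ℝ ξ x), contDiff_ridge (contDiff_expITail K) ξ⟩ :
        smoothFunctions E) = ⟨fun x ↦ expI (inner ℝ ξ x), contDiff_ridge contDiff_expI ξ⟩ -
        ∑ k ∈ Finset.range K, ((2 * Real.pi * Complex.I) ^ k / (k.factorial : ℂ)) •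
          ⟨fun x ↦ ((inner ℝ ξ x : ℝ) : ℂ) ^ k, contDiff_inner_pow ξ k⟩ := by
      ext x
      simp only [expITail, AddSubgroupClass.coe_sub, AddSubmonoidClass.coe_finsetSum,
        Submodule.coe_smul, Pi.sub_apply, Finset.sum_apply, Pi.smul_apply, smul_eq_mul]
      congr 1
      exact Finset.sum_congr rfl fun k _ ↦ by rw [mul_pow]; ring
    rw [this, map_sub, map_sum]
    simp [hpow]
  set r := 2 * Real.pi * (‖ξ‖ * R) with hr
  set ε : ℕ → ℝ := fun K ↦ Real.exp r - ∑ k ∈ Finset.range K, r ^ k / (k.factorial : ℝ) with hε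
  -- Adding 1 to each base makes the powers increasing, so A dominates (2π‖ξ‖)ⁿ for every n ≤ N.
  set A : ℝ := (1 + 2 * Real.pi) ^ N * (1 + ‖ξ‖) ^ N with hA
  have hA0 : 0 ≤ A := by positivity
  -- A point of Q is needed to see that r and ε are nonnegative: the radius R may be negative when Q
  -- is empty.
  by_cases hne : Q.Nonempty
  swap
  · have := hS ⟨fun x ↦ expI (inner ℝ ξ x), contDiff_ridge contDiff_expI ξ⟩ 0 le_rfl
      (by simp [Set.not_nonempty_iff_eq_empty.1 hne])
    simpa using this
  obtain ⟨y₀, hy₀⟩ := hne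
  have hb (y : E) (hy : y ∈ Q) : 2 * Real.pi * |inner ℝ ξ y| ≤ r := by
    rw [hr]
    gcongr
    exact (abs_real_inner_le_norm _ _).trans (by gcongr; exact hR y hy)
  have hε0 (K : ℕ) : 0 ≤ ε K := (norm_nonneg _).trans (norm_expITail_le K (hb y₀ hy₀))
  have hr0 : 0 ≤ r := le_trans (by positivity) (hb y₀ hy₀)
  have hεanti (K j : ℕ) : ε (K + j) ≤ ε K := by
    simp only [hε]
    gcongr
    exact Nat.le_add_right K j
  have hbound (K : ℕ) : ‖S ⟨fun x ↦ expI (inner ℝ ξ x), contDiff_ridge contDiff_expI ξ⟩‖ ≤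
      C * (A * ε K) := by
    -- Removing K + N terms leaves a remainder of order at least K after any n ≤ N derivatives.
    rw [htail (K + N)]
    refine hS _ _ (mul_nonneg hA0 (hε0 K)) fun n hn y hy ↦ ?_
    refine (norm_iteratedFDeriv_ridge_le (contDiff_expITail _) ξ y n).trans ?_
    have h1 : K + N = (K + (N - n)) + n := by omega
    rw [h1, iteratedDeriv_expITail, norm_mul, norm_pow]
    have h2 : ‖(2 * Real.pi * Complex.I : ℂ)‖ = 2 * Real.pi := by simp [abs_of_pos hpi]
    rw [h2]
    have h3 : (2 * Real.pi) ^ n ≤ (1 + 2 * Real.pi) ^ N :=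
      (pow_le_pow_left₀ (by positivity) (by linarith) n).trans
        (pow_le_pow_right₀ (by linarith) hn)
    have h4 : ‖ξ‖ ^ n ≤ (1 + ‖ξ‖) ^ N :=
      (pow_le_pow_left₀ (by positivity) (by linarith) n).trans
        (pow_le_pow_right₀ (by linarith [norm_nonneg ξ]) hn)
    have h5 := (norm_expITail_le (K + (N - n)) (hb y hy)).trans (hεanti K (N - n))
    calc _ ≤ (1 + 2 * Real.pi) ^ N * ε K * (1 + ‖ξ‖) ^ N := by
          have := hε0 K
          gcongr
      _ = _ := by rw [hA]; ring
  have hlim : Filter.Tendsto (fun K ↦ C * (A * ε K)) Filter.atTop (nhds 0) := by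
    simpa using ((tendsto_exp_sub_sum r).const_mul A).const_mul C
  exact norm_le_zero_iff.1 (ge_of_tendsto' hlim hbound)

/-! #### Jets -/

/-- Complex-valued real-multilinear forms in `n` variables, with the operator norm. -/
def MultiForm (E : Type*) [NormedAddCommGroup E] [NormedSpace ℝ E] (n : ℕ) : Type _ :=
  ContinuousMultilinearMap ℝ (fun _ : Fin n ↦ E) ℂ

instance (n : ℕ) : NormedAddCommGroup (MultiForm E n) :=
  inferInstanceAs (NormedAddCommGroup (ContinuousMultilinearMap ℝ (fun _ : Fin n ↦ E) ℂ))

instance (n : ℕ) : NormedSpace ℂ (MultiForm E n) :=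
  inferInstanceAs (NormedSpace ℂ (ContinuousMultilinearMap ℝ (fun _ : Fin n ↦ E) ℂ))

instance (n : ℕ) : CompleteSpace (MultiForm E n) :=
  inferInstanceAs (CompleteSpace (ContinuousMultilinearMap ℝ (fun _ : Fin n ↦ E) ℂ))

/-- Tuples of continuous multilinear-map-valued functions on `Q`, of orders at most `N`. -/
abbrev JetSpace (Q : Set E) (N : ℕ) : Type _ :=
  (n : Fin (N + 1)) → C(Q, MultiForm E n)

/-- The restrictions to `Q` of the derivatives of order at most `N`. -/
def jet (Q : Set E) (N : ℕ) : smoothFunctions E →ₗ[ℂ] JetSpace Q N where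
  toFun f n := ⟨fun y ↦ iteratedFDeriv ℝ n (f : E → ℂ) y,
    ((contDiff_smoothFunctions f).continuous_iteratedFDeriv (mod_cast le_top)).comp
      continuous_subtype_val⟩
  map_add' f g := by
    refine funext fun n ↦ ContinuousMap.ext fun y ↦ ?_
    exact iteratedFDeriv_add_apply ((contDiff_smoothFunctions f).contDiffAt.of_le (mod_cast le_top))
      ((contDiff_smoothFunctions g).contDiffAt.of_le (mod_cast le_top))
  map_smul' c f := by
    refine funext fun n ↦ ContinuousMap.ext fun y ↦ ?_
    exact iteratedFDeriv_const_smul_apply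
      ((contDiff_smoothFunctions f).contDiffAt.of_le (mod_cast le_top))

@[simp]
theorem jet_apply (f : smoothFunctions E) (n : Fin (N + 1)) (y : Q) :
    jet Q N f n y = iteratedFDeriv ℝ n (f : E → ℂ) y := rfl

theorem OrderBound.norm_le_jet [CompactSpace Q] (hS : OrderBound S Q N C)
    (f : smoothFunctions E) : ‖S f‖ ≤ C * ‖jet Q N f‖ := by
  refine hS f _ (norm_nonneg _) fun n hn y hy ↦ ?_
  have h1 := norm_le_pi_norm (jet Q N f) ⟨n, Nat.lt_succ_of_le hn⟩
  exact ((jet Q N f ⟨n, Nat.lt_succ_of_le hn⟩).norm_coe_le_norm ⟨y, hy⟩).trans h1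

/-- If the jet of `f` is a limit of jets of functions in the kernel then `f` is in the kernel. -/
theorem OrderBound.eq_zero_of_jet_mem_closure [CompactSpace Q] (hS : OrderBound S Q N C)
    (f : smoothFunctions E)
    (hf : jet Q N f ∈ (S.ker.map (jet Q N)).topologicalClosure) : S f = 0 := by
  by_contra hne
  have hpos : 0 < ‖S f‖ := norm_pos_iff.2 hne
  obtain ⟨_, ⟨u, hu, rfl⟩, hd⟩ :=
    -- No sign is assumed on C; 1 + |C| is positive and at least C.
    (Metric.mem_closure_iff (α := JetSpace Q N)).1 hf (‖S f‖ / (1 + |C|)) (by positivity)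
  have h1 := hS.norm_le_jet (f - u)
  rw [map_sub, map_sub, (LinearMap.mem_ker.1 hu : S u = 0), sub_zero, ← dist_eq_norm] at h1
  have h2 : C * dist (jet Q N f) (jet Q N u) ≤
      (1 + |C|) * dist (jet Q N f) (jet Q N u) := by
    gcongr
    linarith [le_abs_self C]
  rw [lt_div_iff₀ (by positivity)] at hd
  linarith

/-! ### Fourier inversion as an integral in the Banach space of jets -/

theorem integral_mem_of_isClosed {X B : Type*} [MeasurableSpace X] {μ : MeasureTheory.Measure X}
    [NormedAddCommGroup B] [NormedSpace ℂ B] [CompleteSpace B] (V : Submodule ℂ B)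
    (hV : IsClosed (V : Set B)) {F : X → B} (hF : MeasureTheory.Integrable F μ)
    (hm : ∀ x, F x ∈ V) : ∫ x, F x ∂μ ∈ V := by
  have : IsClosed (V : Set B) := hV
  -- The quotient map by the closed subspace V is continuous and linear, so it commutes with the
  -- integral and annihilates the integrand.
  rw [← Submodule.Quotient.mk_eq_zero V, ← Submodule.mkQ_apply, ← Submodule.mkQL_apply,
    ← ContinuousLinearMap.integral_comp_comm _ hF]
  have : ∀ x, V.mkQL (F x) = 0 := fun x ↦ by
    rw [Submodule.mkQL_apply, Submodule.mkQ_apply, Submodule.Quotient.mk_eq_zero]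
    exact hm x
  simp [this]

open MeasureTheory Real VectorFourier in
/-- The jets of the exponentials appearing in the Fourier integral of `v`. -/
def fourierJet (Q : Set E) (N : ℕ) (v : 𝓢(E, ℂ)) (ξ : E) : JetSpace Q N := fun n ↦
  ⟨fun x ↦ expI (inner ℝ (-ξ) (x : E)) • fourierPowSMulRight (innerSL ℝ) v ξ n, by
    refine Continuous.smul (contDiff_expI.continuous.comp ?_) continuous_const
    exact continuous_const.inner continuous_subtype_val⟩

-- Differentiating the exponential n times produces exactly the factor (-2πi)ⁿ∏⟨ξ, mᵢ⟩ built into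
-- `fourierPowSMulRight`. The left side suits the integral, the right side shows membership in the
-- jets of the kernel.
open VectorFourier in
theorem fourierJet_eq (v : 𝓢(E, ℂ)) (ξ : E) : fourierJet Q N v ξ =
    jet Q N (v ξ • ⟨fun x ↦ expI (inner ℝ (-ξ) x), contDiff_ridge contDiff_expI (-ξ)⟩) := by
  refine funext fun n ↦ ContinuousMap.ext fun y ↦ ContinuousMultilinearMap.ext fun m ↦ ?_
  rw [map_smul]
  change expI (inner ℝ (-ξ) (y : E)) • fourierPowSMulRight (innerSL ℝ) v ξ n m =
    v ξ • iteratedFDeriv ℝ n (fun x : E ↦ expI (inner ℝ (-ξ) x)) y m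
  rw [iteratedFDeriv_ridge_apply contDiff_expI, iteratedDeriv_expI, fourierPowSMulRight_apply]
  have h (i) : innerSL ℝ ξ (m i) = inner ℝ ξ (m i) := rfl
  simp only [inner_neg_left, Finset.prod_neg, h, smul_eq_mul,
    Complex.real_smul, Finset.card_univ, Fintype.card_fin]
  push_cast
  rw [neg_pow (2 * Real.pi * Complex.I : ℂ)]
  ring

-- The n-th component has norm at most a constant times ‖ξ‖ⁿ‖v ξ‖, integrable because v is Schwartz.
open MeasureTheory VectorFourier in
theorem integrable_fourierJet [FiniteDimensional ℝ E] [MeasurableSpace E] [BorelSpace E]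
    [CompactSpace Q] (v : 𝓢(E, ℂ)) : Integrable (fourierJet Q N v) := by
  have hc : Continuous (fourierJet Q N v) := by
    refine continuous_pi fun n ↦ ContinuousMap.continuous_of_continuous_uncurry _ ?_
    refine Continuous.smul (contDiff_expI.continuous.comp ?_) ?_
    · exact continuous_fst.neg.inner (continuous_subtype_val.comp continuous_snd)
    · exact (v.continuous.fourierPowSMulRight (innerSL ℝ) n).comp continuous_fst
  have hg : Integrable (fun ξ : E ↦ ∑ n : Fin (N + 1),
      (2 * Real.pi * ‖(innerSL ℝ : E →L[ℝ] E →L[ℝ] ℝ)‖) ^ (n : ℕ) *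
        (‖ξ‖ ^ (n : ℕ) * ‖v ξ‖)) :=
    integrable_finsetSum _ fun n _ ↦ (v.integrable_pow_mul volume n).const_mul _
  refine hg.mono' hc.aestronglyMeasurable (Filter.Eventually.of_forall fun ξ ↦ ?_)
  have hpos : 0 ≤ 2 * Real.pi * ‖(innerSL ℝ : E →L[ℝ] E →L[ℝ] ℝ)‖ :=
    by positivity
  refine (pi_norm_le_iff_of_nonneg (Finset.sum_nonneg fun n _ ↦ by positivity)).2 fun n ↦ ?_
  refine (ContinuousMap.norm_le _ (Finset.sum_nonneg fun n _ ↦ by positivity)).2 fun x ↦ ?_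
  change ‖expI (inner ℝ (-ξ) (x : E)) • fourierPowSMulRight (innerSL ℝ) v ξ n‖ ≤ _
  rw [norm_smul, norm_expI, one_mul]
  refine (norm_fourierPowSMulRight_le (innerSL ℝ) v ξ n).trans ?_
  rw [mul_assoc]
  exact Finset.single_le_sum (f := fun n : Fin (N + 1) ↦
    (2 * Real.pi * ‖(innerSL ℝ : E →L[ℝ] E →L[ℝ] ℝ)‖) ^ (n : ℕ) * (‖ξ‖ ^ (n : ℕ) * ‖v ξ‖))
    (fun n _ ↦ by positivity) (Finset.mem_univ n)

open MeasureTheory VectorFourier in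
theorem integral_fourierJet [FiniteDimensional ℝ E] [MeasurableSpace E] [BorelSpace E]
    [CompactSpace Q] (v : 𝓢(E, ℂ)) :
    ∫ ξ, fourierJet Q N v ξ = jet Q N ⟨(𝓕 v : 𝓢(E, ℂ)), (𝓕 v : 𝓢(E, ℂ)).smooth ⊤⟩ := by
  refine funext fun n ↦ ContinuousMap.ext fun y ↦ ?_
  have h1 : (∫ ξ, fourierJet Q N v ξ) n y = ∫ ξ, fourierJet Q N v ξ n y :=
    (((ContinuousMap.evalCLM ℝ y).comp
      (ContinuousLinearMap.proj (R := ℝ) (φ := fun n : Fin (N + 1) ↦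
        C(Q, MultiForm E n)) n)).integral_comp_comm
      (integrable_fourierJet v)).symm
  rw [h1, jet_apply]
  change _ = iteratedFDeriv ℝ n (𝓕 v : 𝓢(E, ℂ)) y
  rw [SchwartzMap.fourier_coe, Real.iteratedFDeriv_fourier (N := ⊤)
    (fun k _ ↦ v.integrable_pow_mul volume k) v.continuous.aestronglyMeasurable le_top,
    Real.fourier_eq']
  have hexp (ξ : E) : Complex.exp (↑(-2 * Real.pi * inner ℝ ξ (y : E)) * Complex.I) =
      expI (inner ℝ (-ξ) (y : E)) := by
    rw [expI, inner_neg_left]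
    congr 1
    push_cast
    ring
  simp_rw [hexp]
  rfl

/-- A functional of finite order on a compact set that vanishes on all powers of linear forms
vanishes on Schwartz functions. -/
theorem OrderBound.eq_zero [FiniteDimensional ℝ E] (hQ : IsCompact Q) (hS : OrderBound S Q N C)
    (hpow : ∀ ξ k, S ⟨fun x ↦ ((inner ℝ ξ x : ℝ) : ℂ) ^ k, contDiff_inner_pow ξ k⟩ = 0)
    (f : 𝓢(E, ℂ)) : S ⟨f, f.smooth ⊤⟩ = 0 := by
  borelize E
  have : CompactSpace Q := isCompact_iff_compactSpace.1 hQ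
  refine hS.eq_zero_of_jet_mem_closure _ ?_
  -- By inversion f is the Fourier transform of v = 𝓕⁻ f, hence a superposition of exponentials that
  -- S kills.
  have h : (⟨f, f.smooth ⊤⟩ : smoothFunctions E) =
      ⟨(𝓕 (𝓕⁻ f : 𝓢(E, ℂ)) : 𝓢(E, ℂ)), (𝓕 (𝓕⁻ f : 𝓢(E, ℂ)) : 𝓢(E, ℂ)).smooth ⊤⟩ := by
    ext x
    simp
  rw [h, ← integral_fourierJet]
  refine integral_mem_of_isClosed _ (Submodule.isClosed_topologicalClosure _)
    (integrable_fourierJet _) fun ξ ↦ Submodule.le_topologicalClosure _ ?_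
  rw [fourierJet_eq]
  refine Submodule.mem_map_of_mem (LinearMap.mem_ker.2 ?_)
  rw [map_smul, apply_expI_eq_zero hQ hS (-ξ) (hpow (-ξ)), smul_zero]

end Functional

/-! ### Pulling back smooth functions and pairing with a tempered distribution -/

section Pullback

variable {E F : Type*} [NormedAddCommGroup E] [NormedSpace ℝ E]

/-- The Schwartz function `η · (f ∘ Ψ)` for a compactly supported `η`. -/
def cutoffComp [NormedAddCommGroup F] [NormedSpace ℝ F] {η : 𝓢(E, ℂ)} (hη : HasCompactSupport η)
    {Ψ : E → F} (hΨ : ContDiff ℝ ∞ Ψ) (f : smoothFunctions F) : 𝓢(E, ℂ) :=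
  (hη.mul_right (f' := fun x ↦ (f : F → ℂ) (Ψ x))).toSchwartzMap
    ((η.smooth ⊤).mul ((contDiff_smoothFunctions f).comp hΨ))

theorem cutoffComp_apply [NormedAddCommGroup F] [NormedSpace ℝ F] {η : 𝓢(E, ℂ)}
    (hη : HasCompactSupport η) {Ψ : E → F} (hΨ : ContDiff ℝ ∞ Ψ) (f : smoothFunctions F) (x : E) :
    cutoffComp hη hΨ f x = η x * (f : F → ℂ) (Ψ x) := rfl

/-- The functional `f ↦ ⟨τ, η · (f ∘ Ψ)⟩` on smooth functions. -/
def pullback [NormedAddCommGroup F] [NormedSpace ℝ F] (τ : 𝓢'(E, ℂ)) {η : 𝓢(E, ℂ)}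
    (hη : HasCompactSupport η) {Ψ : E → F} (hΨ : ContDiff ℝ ∞ Ψ) :
    smoothFunctions F →ₗ[ℂ] ℂ where
  toFun f := τ (cutoffComp hη hΨ f)
  map_add' f f' := by
    rw [← map_add]
    congr 1
    ext x
    simp [cutoffComp_apply, mul_add]
  map_smul' c f := by
    rw [RingHom.id_apply, ← map_smul]
    congr 1
    ext x
    simp [cutoffComp_apply, mul_left_comm]

variable [NormedAddCommGroup F] [NormedSpace ℝ F] {η : 𝓢(E, ℂ)} {Ψ : E → F}

/-- The geometric form Dⁱ is what the chain rule bound `norm_iteratedFDeriv_comp_le` asks of the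
inner function. -/
theorem exists_iteratedFDeriv_le_pow {K : Set E} (hK : IsCompact K) (hΨ : ContDiff ℝ ∞ Ψ) (N : ℕ) :
    ∃ D : ℝ, 0 ≤ D ∧ ∀ x ∈ K, ∀ i, 1 ≤ i → i ≤ N → ‖iteratedFDeriv ℝ i Ψ x‖ ≤ D ^ i := by
  have h (i : ℕ) : ∃ B : ℝ, ∀ x ∈ K, ‖iteratedFDeriv ℝ i Ψ x‖ ≤ B :=
    hK.exists_bound_of_continuousOn (hΨ.continuous_iteratedFDeriv (mod_cast le_top)).continuousOn
  choose B hB using h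
  have h0 : 0 ≤ ∑ i ∈ Finset.range (N + 1), |B i| := Finset.sum_nonneg fun i _ ↦ abs_nonneg _
  refine ⟨1 + ∑ i ∈ Finset.range (N + 1), |B i|, by positivity, fun x hx i hi hiN ↦ ?_⟩
  calc _ ≤ |B i| := (hB i x hx).trans (le_abs_self _)
    _ ≤ ∑ i ∈ Finset.range (N + 1), |B i| :=
      Finset.single_le_sum (f := fun i ↦ |B i|) (fun i _ ↦ abs_nonneg _)
        (Finset.mem_range.2 (Nat.lt_succ_of_le hiN))
    _ ≤ 1 + ∑ i ∈ Finset.range (N + 1), |B i| := by linarith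
    _ ≤ _ := le_self_pow₀ (by linarith) (by omega)

theorem exists_seminorm_cutoffComp_le (hη : HasCompactSupport η) (hΨ : ContDiff ℝ ∞ Ψ) (k n : ℕ) :
    ∃ B : ℝ, 0 ≤ B ∧ ∀ (f : smoothFunctions F) (M : ℝ), 0 ≤ M →
      (∀ i ≤ n, ∀ y ∈ Ψ '' tsupport η, ‖iteratedFDeriv ℝ i (f : F → ℂ) y‖ ≤ M) →
      SchwartzMap.seminorm ℂ k n (cutoffComp hη hΨ f) ≤ B * M := by
  obtain ⟨D, hD0, hD⟩ := exists_iteratedFDeriv_le_pow hη.isCompact hΨ n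
  have hs (i : ℕ) := apply_nonneg (SchwartzMap.seminorm ℝ k i) η
  have hB : 0 ≤ ∑ i ∈ Finset.range (n + 1), (n.choose i : ℝ) * SchwartzMap.seminorm ℝ k i η *
      ((n - i).factorial * D ^ (n - i)) := Finset.sum_nonneg fun i _ ↦ by
    have := hs i
    positivity
  refine ⟨_, hB, fun f M hM hf ↦ SchwartzMap.seminorm_le_bound ℂ k n _ (by positivity) fun x ↦ ?_⟩
  by_cases hx : x ∈ tsupport η
  · have hfc := contDiff_smoothFunctions f
    have hle (j : ℕ) : (j : WithTop ℕ∞) ≤ ∞ := mod_cast le_top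
    have hmul := norm_iteratedFDeriv_mul_le (𝕜 := ℝ) (N := ∞) (η.smooth ⊤) (hfc.comp hΨ) x (n := n)
      (mod_cast le_top)
    calc _ ≤ ‖x‖ ^ k * ∑ i ∈ Finset.range (n + 1), (n.choose i : ℝ) * ‖iteratedFDeriv ℝ i η x‖ *
            ‖iteratedFDeriv ℝ (n - i) ((f : F → ℂ) ∘ Ψ) x‖ := by
          gcongr
          exact hmul
      _ = ∑ i ∈ Finset.range (n + 1), (n.choose i : ℝ) * (‖x‖ ^ k * ‖iteratedFDeriv ℝ i η x‖) *
            ‖iteratedFDeriv ℝ (n - i) ((f : F → ℂ) ∘ Ψ) x‖ := by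
          rw [Finset.mul_sum]
          exact Finset.sum_congr rfl fun i _ ↦ by ring
      _ ≤ ∑ i ∈ Finset.range (n + 1), (n.choose i : ℝ) * SchwartzMap.seminorm ℝ k i η *
            ((n - i).factorial * M * D ^ (n - i)) := by
          refine Finset.sum_le_sum fun i _ ↦ ?_
          have := hs i
          gcongr
          · exact SchwartzMap.le_seminorm ℝ k i η x
          · exact norm_iteratedFDeriv_comp_le hfc hΨ (hle (n - i)) x
              (fun j hj ↦ hf j (hj.trans (Nat.sub_le n i)) _ (Set.mem_image_of_mem _ hx))
              fun j hj hj' ↦ hD x hx j hj (hj'.trans (Nat.sub_le n i))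
      _ = _ := by
          rw [Finset.sum_mul]
          exact Finset.sum_congr rfl fun i _ ↦ by ring
  · have h0 : iteratedFDeriv ℝ n (cutoffComp hη hΨ f) x = 0 := by
      by_contra hne
      refine hx ?_
      have h1 := support_iteratedFDeriv_subset (𝕜 := ℝ) n hne
      exact closure_mono (fun y hy ↦ left_ne_zero_of_mul hy) h1
    rw [h0, norm_zero, mul_zero]
    positivity

/-- Continuity bounds τ by finitely many Schwartz seminorms; N is the highest derivative order among
them. This is what supplies an `OrderBound`. -/
theorem exists_norm_pullback_le (τ : 𝓢'(E, ℂ)) (hη : HasCompactSupport η) (hΨ : ContDiff ℝ ∞ Ψ) :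
    ∃ (N : ℕ) (C : ℝ), ∀ (f : smoothFunctions F) (M : ℝ), 0 ≤ M →
      (∀ n ≤ N, ∀ y ∈ Ψ '' tsupport η, ‖iteratedFDeriv ℝ n (f : F → ℂ) y‖ ≤ M) →
      ‖pullback τ hη hΨ f‖ ≤ C * M := by
  let q : Seminorm ℂ 𝓢(E, ℂ) := (normSeminorm ℂ ℂ).comp (τ : 𝓢(E, ℂ) →L[ℂ] ℂ).toLinearMap
  have hq : Continuous q := (τ : 𝓢(E, ℂ) →L[ℂ] ℂ).continuous.norm
  obtain ⟨s, C, -, hC⟩ := Seminorm.bound_of_continuous (schwartz_withSeminorms ℂ E ℂ) q hq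
  choose B hB0 hB using fun p : ℕ × ℕ ↦ exists_seminorm_cutoffComp_le hη hΨ p.1 p.2
  have hB1 : 0 ≤ ∑ p ∈ s, B p := Finset.sum_nonneg fun p _ ↦ hB0 p
  refine ⟨s.sup Prod.snd, C * ∑ p ∈ s, B p, fun f M hM hf ↦ ?_⟩
  have h1 : ‖pullback τ hη hΨ f‖ ≤ C * (s.sup (schwartzSeminormFamily ℂ E ℂ))
    (cutoffComp hη hΨ f) := hC (cutoffComp hη hΨ f)
  refine h1.trans ?_
  rw [mul_assoc]
  gcongr
  refine Seminorm.finset_sup_apply_le (by positivity) fun p hp ↦ ?_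
  refine (hB p f M hM fun i hi ↦ hf i (hi.trans (Finset.le_sup (f := Prod.snd) hp))).trans ?_
  gcongr
  exact Finset.single_le_sum (f := B) (fun p _ ↦ hB0 p) hp

end Pullback

/-! ### A uniqueness theorem for compactly supported distributions -/

/-- Transport h to O by Φ and extend by zero. The extension is smooth across the boundary of O
because its support lies in the compact set Ψ(supp h) ⊆ O. -/
theorem smooth_extension {E : Type*} [NormedAddCommGroup E] [NormedSpace ℝ E] {h : E → ℂ}
    (hh : ContDiff ℝ ∞ h) (hc : HasCompactSupport h) {Ψ Φ : E → E} (hΨ : Continuous Ψ) {O : Set E}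
    (hO : IsOpen O) (hΨO : ∀ x, Ψ x ∈ O) (hΦ : ContDiffOn ℝ ∞ Φ O) (hΦΨ : ∀ x, Φ (Ψ x) = x)
    (hΨΦ : ∀ y ∈ O, Ψ (Φ y) = y) :
    ∃ H : 𝓢(E, ℂ), ∀ x, H (Ψ x) = h x := by
  classical
  let H : E → ℂ := fun y ↦ if y ∈ O then h (Φ y) else 0
  have hK : IsCompact (Ψ '' tsupport h) := hc.isCompact.image hΨ
  have hzero (y) (hy : y ∉ Ψ '' tsupport h) : H y = 0 := by
    by_cases hyO : y ∈ O
    · simp only [H, if_pos hyO]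
      refine image_eq_zero_of_notMem_tsupport fun hm ↦ hy ⟨Φ y, hm, hΨΦ y hyO⟩
    · simp only [H, if_neg hyO]
  have hsm : ContDiff ℝ ∞ H := by
    refine contDiff_iff_contDiffAt.2 fun y ↦ ?_
    by_cases hyO : y ∈ O
    · have h1 : ContDiffAt ℝ ∞ (h ∘ Φ) y :=
        hh.contDiffAt.comp y (hΦ.contDiffAt (hO.mem_nhds hyO))
      refine h1.congr_of_eventuallyEq ?_
      filter_upwards [hO.mem_nhds hyO] with z hz
      simp [H, hz]
    · have hy : y ∉ Ψ '' tsupport h := by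
        rintro ⟨x, -, rfl⟩
        exact hyO (hΨO x)
      refine (contDiffAt_const (c := (0 : ℂ))).congr_of_eventuallyEq ?_
      filter_upwards [hK.isClosed.isOpen_compl.mem_nhds hy] with z hz
      exact hzero z hz
  have hHc : HasCompactSupport H := HasCompactSupport.intro hK hzero
  refine ⟨hHc.toSchwartzMap hsm, fun x ↦ ?_⟩
  change H (Ψ x) = h x
  simp [H, hΨO, hΦΨ]

/-- A compactly supported distribution vanishing on all products of a nowhere zero function `g`
and a polynomial in the components of a smooth embedding `Ψ` is zero. -/
theorem eq_zero_of_apply_mul_pow {E : Type*} [NormedAddCommGroup E] [InnerProductSpace ℝ E]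
    [FiniteDimensional ℝ E] (τ : 𝓢'(E, ℂ)) (hτ : IsCompact (Distribution.dsupport τ))
    (g : 𝓢(E, ℂ)) (hg : ∀ x, g x ≠ 0) {Ψ Φ : E → E} (hΨ : ContDiff ℝ ∞ Ψ) {O : Set E}
    (hO : IsOpen O) (hΨO : ∀ x, Ψ x ∈ O) (hΦ : ContDiffOn ℝ ∞ Φ O) (hΦΨ : ∀ x, Φ (Ψ x) = x)
    (hΨΦ : ∀ y ∈ O, Ψ (Φ y) = y)
    (hpow : ∀ (ξ : E) (k : ℕ), ∃ u : 𝓢(E, ℂ),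
      (∀ x, u x = g x * ((inner ℝ ξ (Ψ x) : ℝ) : ℂ) ^ k) ∧ τ u = 0) : τ = 0 := by
  ext u
  change τ u = 0
  refine apply_eq_zero_of_cutoff τ u fun χ₀ hχ₀ ↦ ?_
  have hf := hasCompactSupport_cutoff hχ₀ u
  generalize cutoff χ₀ u = f at hf
  -- Near supp f, χ = 1 gives f = χg·(H∘Ψ) with H∘Ψ = f/g; near supp τ, it lets χ be inserted in the
  -- hypothesis on powers without changing the value of τ.
  obtain ⟨χ, hχc, U, hUo, hKU, hU⟩ := exists_cutoff_one_near _ (hf.isCompact.union hτ)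
  have hη := hasCompactSupport_cutoff hχc g
  obtain ⟨N, C, hN⟩ := exists_norm_pullback_le τ hη hΨ
  have hS : OrderBound (pullback τ hη hΨ) (Ψ '' tsupport (cutoff χ g)) N C := hN
  have hh : ContDiff ℝ ∞ (fun x ↦ f x * (g x)⁻¹) := (f.smooth ⊤).mul ((g.smooth ⊤).inv hg)
  obtain ⟨H, hH⟩ := smooth_extension hh hf.mul_right hΨ.continuous hO hΨO hΦ hΦΨ hΨΦ
  have h0 := hS.eq_zero (hη.isCompact.image hΨ.continuous) (fun ξ k ↦ ?_) H
  · have h1 : f = cutoffComp hη hΨ ⟨H, H.smooth ⊤⟩ := by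
      ext x
      rw [cutoffComp_apply]
      change f x = cutoff χ g x * H (Ψ x)
      rw [cutoff_apply, hH]
      by_cases hx : x ∈ tsupport f
      · rw [hU x (hKU (Or.inl hx))]
        field_simp [hg x]
      · rw [image_eq_zero_of_notMem_tsupport hx]
        ring
    rw [h1]
    exact h0
  · obtain ⟨v, hv, hτv⟩ := hpow ξ k
    have h1 : cutoffComp hη hΨ ⟨_, contDiff_inner_pow ξ k⟩ = cutoff χ v := by
      ext x
      rw [cutoffComp_apply, cutoff_apply, cutoff_apply, hv, mul_assoc]
    change τ (cutoffComp hη hΨ ⟨_, contDiff_inner_pow ξ k⟩) = 0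
    rw [h1]
    have h2 : τ (v - cutoff χ v) = 0 := by
      refine apply_eq_zero_of_tsupport_subset τ _ ?_
      have h3 : tsupport (v - cutoff χ v) ⊆ Uᶜ := by
        refine closure_minimal (fun x hx hxU ↦ hx ?_) hUo.isClosed_compl
        simp [hU x hxU]
      exact h3.trans (Set.compl_subset_compl.2 (Set.subset_union_right.trans hKU))
    rw [map_sub, hτv, zero_sub, neg_eq_zero] at h2
    exact h2

section Gaussian

open MeasureTheory

/-! ### Gaussian computations -/

theorem fourier_timeFreqShift_gaussian (p q ξ : ℝ) :
    𝓕 (timeFreqShift (p, q) gaussian) ξ =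
      Complex.exp (-Real.pi * (ξ - q) ^ 2 - 2 * Real.pi * Complex.I * p * (ξ - q)) := by
  rw [SchwartzMap.fourier_coe, Real.fourier_real_eq_integral_exp_smul]
  have hpi : (Real.pi : ℂ) ≠ 0 := by exact_mod_cast Real.pi_ne_zero
  have h (t : ℝ) : Complex.exp (↑(-2 * Real.pi * t * ξ) * Complex.I) •
      timeFreqShift (p, q) gaussian t = Complex.exp ((-Real.pi : ℂ) * t ^ 2 +
        (2 * Real.pi * p + 2 * Real.pi * Complex.I * (q - ξ)) * t + (-Real.pi * p ^ 2)) := by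
    rw [timeFreqShift_apply, gaussian_apply, expI, smul_eq_mul, Complex.ofReal_exp,
      ← Complex.exp_add, ← Complex.exp_add]
    congr 1
    push_cast
    ring
  simp_rw [h]
  rw [integral_cexp_quadratic (by simp [Real.pi_pos])]
  rw [neg_neg, div_self hpi, Complex.one_cpow, one_mul]
  congr 1
  field_simp
  ring_nf
  simp only [Complex.I_sq]
  ring

theorem integral_plane {f : Plane → ℂ} (hf : Integrable f) :
    ∫ z, f z = ∫ y : ℝ, ∫ x : ℝ, f (!₂[x, y]) := by
  have h1 := (PiLp.volume_preserving_toLp (Fin 2)).integral_comp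
    (MeasurableEquiv.toLp 2 (Fin 2 → ℝ)).measurableEmbedding f
  have h2 := (volume_preserving_finTwoArrow ℝ).symm.integral_comp
    (MeasurableEquiv.finTwoArrow (α := ℝ)).symm.measurableEmbedding
    (fun w ↦ f (WithLp.toLp 2 w))
  have hi : Integrable (fun z : ℝ × ℝ ↦ f (!₂[z.1, z.2])) := by
    have h3 := (PiLp.volume_preserving_toLp (Fin 2)).integrable_comp_emb
      (MeasurableEquiv.toLp 2 (Fin 2 → ℝ)).measurableEmbedding (g := f)
    have h4 := (volume_preserving_finTwoArrow ℝ).symm.integrable_comp_emb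
      (MeasurableEquiv.finTwoArrow (α := ℝ)).symm.measurableEmbedding
      (g := fun w ↦ f (WithLp.toLp 2 w))
    exact h4.2 (h3.2 hf)
  rw [← h1, ← h2]
  exact integral_prod_symm _ hi

/-- The function whose pairing with `σ` is the channel matrix entry at `(λ, -λ)`, seen on the
Fourier side. -/
def spreadingGaussian (p q : ℝ) : 𝓢(Plane, ℂ) :=
  𝓕⁻ (conjS Plane (rihaczek (timeFreqShift (p, q) gaussian) (timeFreqShift (-p, -q) gaussian)))

theorem conj_rihaczek_gaussian (p q : ℝ) (z : Plane) :
    conjS Plane (rihaczek (timeFreqShift (p, q) gaussian) (timeFreqShift (-p, -q) gaussian)) z =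
      Complex.exp (-Real.pi * (z 0 - p) ^ 2 - Real.pi * (z 1 + q) ^ 2 +
        2 * Real.pi * Complex.I * (z 0 * z 1 - q * z 0 + p * (z 1 + q))) := by
  rw [conjS_apply, rihaczek_apply, fourier_timeFreqShift_gaussian, timeFreqShift_apply,
    gaussian_apply, expI, expI, Complex.ofReal_exp]
  simp only [map_mul, ← Complex.exp_conj, Complex.conj_conj]
  rw [← Complex.exp_add, ← Complex.exp_add, ← Complex.exp_add]
  congr 1
  simp only [map_mul, map_neg, map_ofNat, map_pow, map_sub, Complex.conj_ofReal, Complex.conj_I,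
    Complex.ofReal_neg, Complex.ofReal_mul, Complex.ofReal_pow, Complex.ofReal_sub]
  ring

/-- Two successive Gaussian integrals: the x-integral, with quadratic coefficient -π, contributes
the factor 1, and completing its square leaves -2π in y, whence (1/2)^(1/2). -/
theorem spreadingGaussian_apply (p q : ℝ) (w : Plane) :
    spreadingGaussian p q w = (1 / 2 : ℂ) ^ (1 / 2 : ℂ) *
      Complex.exp (Real.pi * (-2 * p ^ 2 - 2 * q ^ 2) +
        Real.pi * ((-(w 0) ^ 2 - (w 1) ^ 2 - 2 * Complex.I * w 0 * w 1) / 2) +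
        2 * Real.pi * (q * w 0 - p * w 1)) := by
  have hpi : (Real.pi : ℂ) ≠ 0 := by exact_mod_cast Real.pi_ne_zero
  set u := conjS Plane (rihaczek (timeFreqShift (p, q) gaussian)
    (timeFreqShift (-p, -q) gaussian)) with hu
  have hint : Integrable (fun v : Plane ↦
      Complex.exp (↑(2 * Real.pi * inner ℝ v w) * Complex.I) • u v) := by
    refine (integrable_norm_iff (Continuous.aestronglyMeasurable ?_)).1 ?_
    · exact Continuous.smul (Complex.continuous_exp.comp ((Complex.continuous_ofReal.comp
        (continuous_const.mul (continuous_id.inner continuous_const))).mul continuous_const))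
        u.continuous
    · simp_rw [norm_smul, Complex.norm_exp_ofReal_mul_I, one_mul]
      exact u.integrable.norm
  rw [spreadingGaussian, ← hu, SchwartzMap.fourierInv_coe, Real.fourierInv_eq', integral_plane hint]
  have h (y x : ℝ) : Complex.exp (↑(2 * Real.pi * inner ℝ (!₂[x, y] : Plane) w) * Complex.I) •
      u (!₂[x, y]) = Complex.exp ((-Real.pi : ℂ) * x ^ 2 +
        2 * Real.pi * (p - Complex.I * q + Complex.I * w 0 + Complex.I * y) * x +
        (-Real.pi * p ^ 2 - Real.pi * (y + q) ^ 2 + 2 * Real.pi * Complex.I * p * (y + q)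
          + 2 * Real.pi * Complex.I * w 1 * y)) := by
    rw [hu, conj_rihaczek_gaussian, smul_eq_mul, ← Complex.exp_add]
    congr 1
    simp [PiLp.inner_apply, Fin.sum_univ_two]
    ring
  simp_rw [h]
  simp_rw [integral_cexp_quadratic (b := (-Real.pi : ℂ)) (by simp [Real.pi_pos])]
  rw [neg_neg, div_self hpi, Complex.one_cpow]
  have h2 (y : ℝ) : (1 : ℂ) * Complex.exp (-Real.pi * p ^ 2 - Real.pi * (y + q) ^ 2 +
      2 * Real.pi * Complex.I * p * (y + q) + 2 * Real.pi * Complex.I * w 1 * y -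
      (2 * Real.pi * (p - Complex.I * q + Complex.I * w 0 + Complex.I * y)) ^ 2 /
        (4 * -Real.pi)) =
      Complex.exp ((-(2 * Real.pi) : ℂ) * y ^ 2 +
        2 * Real.pi * (2 * Complex.I * p + Complex.I * w 1 - w 0) * y +
        (Real.pi * (-p ^ 2 - q ^ 2 + 2 * Complex.I * p * q +
          (p - Complex.I * q + Complex.I * w 0) ^ 2))) := by
    rw [one_mul]
    congr 1
    field_simp
    ring_nf
    simp only [Complex.I_sq]
    ring
  simp_rw [h2]
  rw [integral_cexp_quadratic (by simp [Real.pi_pos])]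
  congr 1
  · congr 1
    field_simp
  · congr 1
    field_simp
    ring_nf
    simp only [Complex.I_sq]
    ring

end Gaussian

/-! ### The exponential change of variables -/

/-- The map `w ↦ (e^{2πb w₀}, e^{2πa w₁})`. -/
def expPlane (a b : ℝ) (w : Plane) : Plane :=
  !₂[Real.exp (2 * Real.pi * b * w 0), Real.exp (2 * Real.pi * a * w 1)]

/-- The inverse of `expPlane` on the open first quadrant. -/
def logPlane (a b : ℝ) (y : Plane) : Plane :=
  !₂[Real.log (y 0) / (2 * Real.pi * b), Real.log (y 1) / (2 * Real.pi * a)]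

theorem contDiff_plane_coord (i : Fin 2) : ContDiff ℝ ∞ (fun w : Plane ↦ w i) :=
  (EuclideanSpace.proj (𝕜 := ℝ) i : Plane →L[ℝ] ℝ).contDiff

theorem contDiff_expPlane (a b : ℝ) : ContDiff ℝ ∞ (expPlane a b) := by
  refine contDiff_piLp' 2 fun i ↦ ?_
  fin_cases i
  · exact Real.contDiff_exp.comp (contDiff_const.mul (contDiff_plane_coord 0))
  · exact Real.contDiff_exp.comp (contDiff_const.mul (contDiff_plane_coord 1))

theorem contDiffOn_logPlane (a b : ℝ) :
    ContDiffOn ℝ ∞ (logPlane a b) {y | 0 < y 0 ∧ 0 < y 1} := by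
  refine contDiffOn_piLp' 2 fun i ↦ ?_
  fin_cases i
  · exact ((contDiff_plane_coord 0).contDiffOn.log fun y hy ↦ hy.1.ne').div_const _
  · exact ((contDiff_plane_coord 1).contDiffOn.log fun y hy ↦ hy.2.ne').div_const _

theorem logPlane_expPlane {a b : ℝ} (ha : 0 < a) (hb : 0 < b) (w : Plane) :
    logPlane a b (expPlane a b w) = w := by
  have := Real.pi_pos
  ext i
  fin_cases i
  · simp [logPlane, expPlane]
    field_simp
  · simp [logPlane, expPlane]
    field_simp

theorem expPlane_logPlane {a b : ℝ} (ha : 0 < a) (hb : 0 < b) (y : Plane) (h0 : 0 < y 0)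
    (h1 : 0 < y 1) : expPlane a b (logPlane a b y) = y := by
  have := Real.pi_pos
  ext i
  fin_cases i
  · simp only [expPlane, logPlane, Fin.zero_eta, PiLp.toLp_apply, Matrix.cons_val_zero]
    rw [mul_div_cancel₀ _ (by positivity), Real.exp_log h0]
  · simp only [expPlane, logPlane, Fin.mk_one, PiLp.toLp_apply, Matrix.cons_val_one,
      Matrix.cons_val_fin_one]
    rw [mul_div_cancel₀ _ (by positivity), Real.exp_log h1]

/-! ### The channel matrix -/

theorem spreadingGaussian_zero_ne_zero (w : Plane) : spreadingGaussian 0 0 w ≠ 0 := by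
  rw [spreadingGaussian_apply]
  refine mul_ne_zero ?_ (Complex.exp_ne_zero _)
  simp [Complex.cpow_eq_zero_iff]

/-- The parameters (p, q) enter the exponent only through a constant and a real linear form in w;
the prefactor cancels the constant. -/
theorem spreadingGaussian_eq_mul (p q : ℝ) (w : Plane) :
    Complex.exp (2 * Real.pi * (p ^ 2 + q ^ 2)) * spreadingGaussian p q w =
      spreadingGaussian 0 0 w * Complex.exp (2 * Real.pi * (q * w 0 - p * w 1)) := by
  rw [spreadingGaussian_apply, spreadingGaussian_apply, mul_left_comm, mul_assoc _ _ (Complex.exp _),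
    ← Complex.exp_add, ← Complex.exp_add]
  congr 2
  push_cast
  ring

theorem fourier_apply_spreadingGaussian (σ : 𝓢'(Plane, ℂ)) (p q : ℝ) :
    (𝓕 σ : 𝓢'(Plane, ℂ)) (spreadingGaussian p q) =
      channelMatrix σ gaussian (p, q) (-(p, q)) := by
  rw [TemperedDistribution.fourier_apply, spreadingGaussian, FourierTransform.fourier_fourierInv_eq,
    channelMatrix, bracket_kohnNirenberg]
  rfl

theorem mem_lattice_nat (a b : ℝ) (m n : ℕ) :
    ((-(a * n), b * m) : ℝ × ℝ) ∈ lattice a b :=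
  ⟨⟨-n, by simp [mul_comm]⟩, ⟨m, by simp [mul_comm]⟩⟩

theorem exists_monomial {a b : ℝ} {σ : 𝓢'(Plane, ℂ)}
    (hH : ∀ l ∈ lattice a b, ∀ m ∈ lattice a b, channelMatrix σ gaussian l m = 0) (m n : ℕ) :
    ∃ u : 𝓢(Plane, ℂ), (∀ w, u w = spreadingGaussian 0 0 w *
      ((expPlane a b w 0 ^ m * expPlane a b w 1 ^ n : ℝ) : ℂ)) ∧
        (𝓕 σ : 𝓢'(Plane, ℂ)) u = 0 := by
  -- The minus sign in p = -an compensates the one in q w₀ - p w₁, so both coordinates of `expPlane`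
  -- appear with nonnegative powers.
  refine ⟨Complex.exp (2 * Real.pi * ((-(a * n) : ℝ) ^ 2 + (b * m : ℝ) ^ 2)) •
    spreadingGaussian (-(a * n)) (b * m), fun w ↦ ?_, ?_⟩
  · rw [smul_apply, smul_eq_mul]
    rw [spreadingGaussian_eq_mul]
    congr 1
    simp only [expPlane, PiLp.toLp_apply, Matrix.cons_val_zero, Matrix.cons_val_one,
      Matrix.cons_val_fin_one]
    rw [← Real.exp_nat_mul, ← Real.exp_nat_mul, ← Real.exp_add, Complex.ofReal_exp]
    congr 1
    push_cast
    ring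
  · rw [map_smul, fourier_apply_spreadingGaussian,
      hH _ (mem_lattice_nat a b m n) _ ((lattice a b).neg_mem (mem_lattice_nat a b m n)), smul_zero]

/-- The binomial theorem expands a power of a linear form into monomials. -/
theorem exists_mul_inner_pow {a b : ℝ} {σ : 𝓢'(Plane, ℂ)}
    (hH : ∀ l ∈ lattice a b, ∀ m ∈ lattice a b, channelMatrix σ gaussian l m = 0)
    (ξ : Plane) (k : ℕ) :
    ∃ u : 𝓢(Plane, ℂ), (∀ w, u w = spreadingGaussian 0 0 w *
      ((inner ℝ ξ (expPlane a b w) : ℝ) : ℂ) ^ k) ∧ (𝓕 σ : 𝓢'(Plane, ℂ)) u = 0 := by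
  choose v hv hτ using exists_monomial hH
  refine ⟨∑ j ∈ Finset.range (k + 1),
    ((ξ 0 ^ j * ξ 1 ^ (k - j) * k.choose j : ℝ) : ℂ) • v j (k - j), fun w ↦ ?_, ?_⟩
  · have hi : inner ℝ ξ (expPlane a b w) = ξ 0 * expPlane a b w 0 + ξ 1 * expPlane a b w 1 := by
      simp [PiLp.inner_apply, Fin.sum_univ_two, mul_comm]
    rw [hi, ← Complex.ofReal_pow, add_pow, Complex.ofReal_sum, Finset.mul_sum, sum_apply]
    refine Finset.sum_congr rfl fun j _ ↦ ?_
    rw [smul_apply, hv, smul_eq_mul]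
    push_cast
    ring
  · rw [map_sum]
    exact Finset.sum_eq_zero fun j _ ↦ by rw [map_smul, hτ, smul_zero]

end Gabor

end

/-! ### Conclusion: the symbol vanishes -/

theorem theorem3 (a b : ℝ) (ha : 0 < a) (hb : 0 < b) (σ : 𝓢'(Gabor.Plane, ℂ))
    (hσ : IsCompact (Distribution.dsupport (𝓕 σ : 𝓢'(Gabor.Plane, ℂ))))
    (hH : ∀ l ∈ Gabor.lattice a b, ∀ m ∈ Gabor.lattice a b,
      Gabor.channelMatrix σ Gabor.gaussian l m = 0) :
    Gabor.kohnNirenberg σ = 0 := by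
  have hO : IsOpen {y : Gabor.Plane | 0 < y 0 ∧ 0 < y 1} :=
    (isOpen_lt continuous_const (Gabor.contDiff_plane_coord 0).continuous).inter
      (isOpen_lt continuous_const (Gabor.contDiff_plane_coord 1).continuous)
  have hτ : (𝓕 σ : 𝓢'(Gabor.Plane, ℂ)) = 0 :=
    Gabor.eq_zero_of_apply_mul_pow _ hσ (Gabor.spreadingGaussian 0 0)
      Gabor.spreadingGaussian_zero_ne_zero (Gabor.contDiff_expPlane a b) hO
      (fun w ↦ ⟨Real.exp_pos _, Real.exp_pos _⟩) (Gabor.contDiffOn_logPlane a b)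
      (Gabor.logPlane_expPlane ha hb) (fun y hy ↦ Gabor.expPlane_logPlane ha hb y hy.1 hy.2)
      (Gabor.exists_mul_inner_pow hH)
  have h0 : σ = 0 := by
    ext u
    have h1 := congrArg (fun τ : 𝓢'(Gabor.Plane, ℂ) ↦ τ (𝓕⁻ u)) hτ
    simpa [TemperedDistribution.fourier_apply, FourierTransform.fourier_fourierInv_eq] using h1
  subst h0
  ext f g
  rfl
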